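/- Let $n\ge 0$, let $(M,g)$ be a smooth $n$-dimensional Riemannian manifold without boundary, and equip $\mathbb{R}\times M$ with the product metric $dt^2+g$. Let $\mathrm{Sym}^2(\mathbb{R}^{n+1})$ be the space of real symmetric $(n+1)\times(n+1)$ matrices (indexed by $0,\dots,n$), let $\mathcal{S}$ be the set of those with all zeros in the first row and column, and let $I_n=\mathrm{diag}(0,1,\dots,1)$. For $A\notin\mathcal{S}$ put $$\widehat\Theta(A)=\sum_{\lambda\in\mathrm{spec}(I_n+\sqrt{-1}A)}m(\lambda)\arg\lambda,\qquad \arg\in(-\pi,\pi],$$ where $m(\lambda)$ is the algebraic multiplicity. Let $\widetilde\Theta$ be the minimal upper semicontinuous extension of $\widehat\Theta$ to $\mathrm{Sym}^2(\mathbb{R}^{n+1})$. For $c\in\left(-\frac{(n+1)\pi}{2},\frac{(n+1)\pi}{2}\right)$ let $\mathcal{F}_c=\{A:\widetilde\Theta(A)\ge c\}$, and let $\mathbf{F}_c=\mathbb{R}\times\mathbb{R}^{n+1}\times\mathcal{F}_c\subset\mathbf{J}^2=\mathbb{R}\times\mathbb{R}^{n+1}\times\mathrm{Sym}^2(\mathbb{R}^{n+1})$.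 For a manifold $X$ with a Riemannian metric, a subequation on $X$ is a subset $F$ of the 2-jet bundle $J^2(X)$ such that (P) $F+P\subset F$, where $P_x$ consists of the jets at $x$ of functions $u$ with $u(x)=0$, $(du)_x=0$, $\mathrm{Hess}_xu\ge 0$; (N) $F+N\subset F$, where $N_x$ consists of the jets of the constants $\le 0$; (T) $F=\overline{\mathrm{Int}\,F}$, $F_x=\overline{\mathrm{Int}\,F_x}$ and $\mathrm{Int}\,F_x=(\mathrm{Int}\,F)_x$ for all $x$. A Euclidean subequation is a subset $\mathbf{F}$ of $\mathbf{J}^2$ such that $\mathbf{F}+\{(0,0,B):B\ge0\}\subset\mathbf{F}$, $\mathbf{F}+\{(s,0,0):s\le0\}\subset\mathbf{F}$ and $\mathbf{F}=\overline{\mathrm{Int}\,\mathbf{F}}$. For a basis $e$ of $T_xX$, $\Phi^e$ sends the 2-jet of $u$ at $x$ to $\big(u(x),(e_i(u))_i,((\mathrm{Hess}_xu)(e_i,e_j))_{i,j}\big)$, where $\mathrm{Hess}$ is the Riemannian Hessian. View $O_n$ as the subgroup $\{\mathrm{diag}(1,h):h\in O_n\}$ of $O_{n+1}$. Then: 1.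 The smooth local frames $(\partial_t,e_1,\dots,e_n)$ of $T(\mathbb{R}\times M)$ over open subsets of $\mathbb{R}\times M$ that are orthonormal for the product metric form a topological $O_n$-structure on $\mathbb{R}\times M$: their domains cover $\mathbb{R}\times M$, and any two of them are related by an $O_n$-valued function on the intersection of their domains. 2. $\mathbf{F}_c$ is a Euclidean subequation, and it is invariant under $O_n$ acting by $H\cdot(r,p,A)=(r,Hp,HAH^t)$. 3. There is a unique subset $F\subset J^2(\mathbb{R}\times M)$ that is a subequation on $\mathbb{R}\times M$ and satisfies, for every frame $e$ in (1), every $x$ in its domain and every 2-jet $J$ at $x$, $$J\in F_x\iff\Phi^e(J)\in\mathbf{F}_c.$$ That is, $\mathbb{R}\times M$ carries a global Riemannian subequation (the Riemannian degenerate special Lagrangian subequation) locally modelled on $\mathcal{F}_c$. -/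

import Mathlib

open Bundle Set Filter Topology Manifold
open scoped ContDiff Pointwise

noncomputable section

/-! ### Symmetric matrices and constant-coefficient subequations in Euclidean space -/

/-- The space `Sym²(ℝᵐ)` of real symmetric `m × m` matrices. -/
def symMatrix (m : ℕ) : Submodule ℝ (Matrix (Fin m) (Fin m) ℝ) where
  carrier := {A | A.IsSymm}
  add_mem' := fun hA hB => hA.add hB
  zero_mem' := Matrix.isSymm_zero
  smul_mem' := fun c _ hA => hA.smul c

abbrev SymMat (m : ℕ) : Type := symMatrix m

/-- `J² = ℝ × ℝᵐ × Sym²(ℝᵐ)`, the fibre of the 2-jet bundle of `ℝᵐ`. -/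
abbrev EuclJet (m : ℕ) : Type := ℝ × (Fin m → ℝ) × SymMat m

/-- `P`: the jets `(0, 0, A)` with `A ≥ 0`. -/
def euclPos (m : ℕ) : Set (EuclJet m) :=
  {J | J.1 = 0 ∧ J.2.1 = 0 ∧ (J.2.2 : Matrix (Fin m) (Fin m) ℝ).PosSemidef}

/-- `N`: the jets `(s, 0, 0)` with `s ≤ 0`. -/
def euclNeg (m : ℕ) : Set (EuclJet m) := {J | J.1 ≤ 0 ∧ J.2 = 0}

/-- A Euclidean subequation `𝐅 ⊂ J²`: conditions (P), (N) and (T). -/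
structure IsEuclSubequation {m : ℕ} (F : Set (EuclJet m)) : Prop where
  pos : F + euclPos m ⊆ F
  neg : F + euclNeg m ⊆ F
  top : F = closure (interior F)

/-- The action `h (r, p, A) = (r, h p, h A hᵗ)` on `J²`. -/
def jetAct {m : ℕ} (h : Matrix (Fin m) (Fin m) ℝ) (J : EuclJet m) : EuclJet m :=
  (J.1, h.mulVec J.2.1, ⟨h * (J.2.2 : Matrix (Fin m) (Fin m) ℝ) * h.transpose, by
    have hA : (J.2.2 : Matrix (Fin m) (Fin m) ℝ).transpose = J.2.2 := J.2.2.2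
    change (h * (J.2.2 : Matrix (Fin m) (Fin m) ℝ) * h.transpose).transpose = _
    simp [Matrix.transpose_mul, hA, Matrix.mul_assoc]⟩)

theorem jetAct_one {m : ℕ} (J : EuclJet m) : jetAct 1 J = J := by
  obtain ⟨r, p, A, hA⟩ := J
  simp [jetAct]

theorem jetAct_mul {m : ℕ} (h k : Matrix (Fin m) (Fin m) ℝ) (J : EuclJet m) :
    jetAct (h * k) J = jetAct h (jetAct k J) := by
  simp [jetAct, Matrix.transpose_mul, Matrix.mul_assoc, Matrix.mulVec_mulVec]

/-- The compact invariance group `G(𝐅) = {h ∈ O_m : h(𝐅) = 𝐅}`. -/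
def invarianceGroup {m : ℕ} (F : Set (EuclJet m)) :
    Subgroup (Matrix.orthogonalGroup (Fin m) ℝ) where
  carrier := {h | jetAct (h : Matrix (Fin m) (Fin m) ℝ) '' F = F}
  one_mem' := by
    simp only [mem_ofPred_eq, OneMemClass.coe_one]
    rw [show jetAct (1 : Matrix (Fin m) (Fin m) ℝ) = id from funext jetAct_one, image_id]
  mul_mem' := by
    intro h k hh hk
    simp only [mem_ofPred_eq] at hh hk ⊢
    have : jetAct ((h * k : Matrix.orthogonalGroup (Fin m) ℝ) : Matrix (Fin m) (Fin m) ℝ) =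
        jetAct (h : Matrix (Fin m) (Fin m) ℝ) ∘ jetAct (k : Matrix (Fin m) (Fin m) ℝ) :=
      funext fun J => jetAct_mul _ _ J
    rw [this, image_comp, hk, hh]
  inv_mem' := by
    intro h hh
    simp only [mem_ofPred_eq] at hh ⊢
    have : jetAct ((h⁻¹ : Matrix.orthogonalGroup (Fin m) ℝ) : Matrix (Fin m) (Fin m) ℝ) ∘
        jetAct (h : Matrix (Fin m) (Fin m) ℝ) = id := by
      funext J
      change jetAct _ (jetAct _ J) = J
      rw [← jetAct_mul, ← Submonoid.coe_mul, inv_mul_cancel, OneMemClass.coe_one, jetAct_one]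
    conv_lhs => rw [← hh]
    rw [← image_comp, this, image_id]

/-- The matrix `diag(1, h)`. -/
def oneBlock {n : ℕ} (h : Matrix (Fin n) (Fin n) ℝ) : Matrix (Fin (n + 1)) (Fin (n + 1)) ℝ :=
  Matrix.of fun i j => Fin.cases (Fin.cases 1 (fun _ => 0) j)
    (fun i' => Fin.cases 0 (fun j' => h i' j') j) i

theorem oneBlock_one {n : ℕ} : oneBlock (1 : Matrix (Fin n) (Fin n) ℝ) = 1 := by
  ext i j
  refine Fin.cases ?_ (fun i => ?_) i <;> refine Fin.cases ?_ (fun j => ?_) j <;>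
    simp [oneBlock, Matrix.one_apply, Fin.succ_ne_zero, eq_comm]

theorem oneBlock_mul {n : ℕ} (h k : Matrix (Fin n) (Fin n) ℝ) :
    oneBlock (h * k) = oneBlock h * oneBlock k := by
  ext i j
  refine Fin.cases ?_ (fun i => ?_) i <;> refine Fin.cases ?_ (fun j => ?_) j <;>
    simp [oneBlock, Matrix.mul_apply, Fin.sum_univ_succ]

theorem oneBlock_transpose {n : ℕ} (h : Matrix (Fin n) (Fin n) ℝ) :
    oneBlock h.transpose = (oneBlock h).transpose := by
  ext i j
  refine Fin.cases ?_ (fun i => ?_) i <;> refine Fin.cases ?_ (fun j => ?_) j <;>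
    simp [oneBlock]

/-- The inclusion `O_n → O_{n+1}`, `h ↦ diag(1, h)`. -/
def oneBlockHom (n : ℕ) :
    Matrix.orthogonalGroup (Fin n) ℝ →* Matrix.orthogonalGroup (Fin (n + 1)) ℝ where
  toFun h := ⟨oneBlock (h : Matrix (Fin n) (Fin n) ℝ), by
    have hh : (h : Matrix (Fin n) (Fin n) ℝ) * (h : Matrix (Fin n) (Fin n) ℝ).transpose = 1 :=
      (Matrix.mem_orthogonalGroup_iff (Fin n) ℝ).1 h.2
    refine (Matrix.mem_orthogonalGroup_iff (Fin (n + 1)) ℝ).2 ?_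
    have h1 : oneBlock (h : Matrix (Fin n) (Fin n) ℝ) *
        (oneBlock (h : Matrix (Fin n) (Fin n) ℝ)).transpose = 1 := by
      rw [← oneBlock_transpose, ← oneBlock_mul, hh, oneBlock_one]
    exact h1⟩
  map_one' := Subtype.ext oneBlock_one
  map_mul' := fun h k => Subtype.ext (oneBlock_mul _ _)

/-- `O_n`, viewed as the subgroup `{diag(1, h) : h ∈ O_n}` of `O_{n+1}`. -/
def orthogonalBlock (n : ℕ) : Subgroup (Matrix.orthogonalGroup (Fin (n + 1)) ℝ) :=
  (oneBlockHom n).range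

/-! ### The Euclidean degenerate special Lagrangian subequation -/

/-- The complex matrix `I_n + √-1 A`, where `I_n = diag(0, 1, …, 1)`. -/
def dslMatrix {n : ℕ} (A : SymMat (n + 1)) : Matrix (Fin (n + 1)) (Fin (n + 1)) ℂ :=
  Matrix.diagonal (fun i => if i = 0 then 0 else 1) +
    Complex.I • (A : Matrix (Fin (n + 1)) (Fin (n + 1)) ℝ).map Complex.ofReal

/-- The symmetric matrices with all zeros in the first row and column. -/
def degenerateSet (n : ℕ) : Set (SymMat (n + 1)) :=
  {A | ∀ i, (A : Matrix (Fin (n + 1)) (Fin (n + 1)) ℝ) 0 i = 0 ∧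
    (A : Matrix (Fin (n + 1)) (Fin (n + 1)) ℝ) i 0 = 0}

/-- `Θ̂(A) = ∑_{λ ∈ spec(I_n + √-1 A)} m(λ) arg λ`, with `arg` in `(-π, π]`. It is meant for `A`
outside `degenerateSet n`. -/
def thetaHat {n : ℕ} (A : SymMat (n + 1)) : ℝ :=
  ((dslMatrix A).charpoly.roots.map Complex.arg).sum

/-- `Θ̃`: the smallest upper semicontinuous function on `Sym²(ℝⁿ⁺¹)` that agrees with `Θ̂`
outside `degenerateSet n`, as the pointwise infimum of all such functions. -/
def thetaTilde {n : ℕ} (A : SymMat (n + 1)) : ℝ :=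
  sInf {r | ∃ f : SymMat (n + 1) → ℝ, UpperSemicontinuous f ∧
    EqOn f thetaHat (degenerateSet n)ᶜ ∧ f A = r}

/-- `𝓕_c = {A ∈ Sym²(ℝⁿ⁺¹) : Θ̃(A) ≥ c}`. -/
def dslSet (n : ℕ) (c : ℝ) : Set (SymMat (n + 1)) := {A | c ≤ thetaTilde A}

/-- `𝓕_c` as a (pure second order) subset `ℝ × ℝⁿ⁺¹ × 𝓕_c` of `J²`. -/
def dslJet (n : ℕ) (c : ℝ) : Set (EuclJet (n + 1)) := {J | J.2.2 ∈ dslSet n c}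

/-! ### The 2-jet bundle of a manifold -/

section Jets

variable {E : Type*} [NormedAddCommGroup E] [NormedSpace ℝ E]
  {H : Type*} [TopologicalSpace H] (I : ModelWithCorners ℝ E H) [I.Boundaryless]
  {X : Type*} [TopologicalSpace X] [ChartedSpace H X] [IsManifold I ∞ X]

/-- The real functions that are smooth near `x`. -/
def smoothNear (x : X) : Submodule ℝ (X → ℝ) where
  carrier := {u | ∀ᶠ y in 𝓝 x, ContMDiffAt I 𝓘(ℝ, ℝ) ∞ u y}
  add_mem' := fun hu hv => by
    filter_upwards [hu, hv] with y h1 h2 using h1.add h2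
  zero_mem' := Eventually.of_forall fun _ => contMDiffAt_const
  smul_mem' := fun c u hu => by
    filter_upwards [hu] with y h1 using (contMDiffAt_const (I := I) (I' := 𝓘(ℝ, ℝ)) (c := c)).smul h1

/-- The function `u` read in the chart `e`. -/
def inChart (e : OpenPartialHomeomorph X H) (u : X → ℝ) : E → ℝ := u ∘ (e.extend I).symm

theorem contDiffAt_inChart {e : OpenPartialHomeomorph X H} (he : e ∈ atlas H X) {x : X}
    (hx : x ∈ e.source) {u : X → ℝ} (hu : ContMDiffAt I 𝓘(ℝ, ℝ) ∞ u x) :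
    ContDiffAt ℝ ∞ (inChart I e u) (e.extend I x) := by
  have h1 := (contMDiffOn_extend_symm (I := I) (n := ∞)
    (IsManifold.subset_maximalAtlas (I := I) (n := ∞) he))
  have hopen : IsOpen (I '' e.target) := by
    have := I.toHomeomorph.isOpenMap _ e.open_target
    exact this
  have hmem : e.extend I x ∈ I '' e.target := ⟨e x, e.map_source hx, rfl⟩
  have h2 := h1.contMDiffAt (hopen.mem_nhds hmem)
  have h3 : (e.extend I).symm (e.extend I x) = x := e.extend_left_inv hx
  rw [← contMDiffAt_iff_contDiffAt]
  refine ContMDiffAt.comp (g := u) _ ?_ h2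
  rwa [h3]

theorem fderiv_add_eventually {f g : E → ℝ} {y : E} (hf : ContDiffAt ℝ ∞ f y)
    (hg : ContDiffAt ℝ ∞ g y) : fderiv ℝ (f + g) =ᶠ[𝓝 y] fderiv ℝ f + fderiv ℝ g := by
  filter_upwards [(hf.of_le (m := 1) (by exact_mod_cast le_top)).eventually (by simp),
    (hg.of_le (m := 1) (by exact_mod_cast le_top)).eventually (by simp)] with z h1 h2
  exact fderiv_add (h1.differentiableAt one_ne_zero) (h2.differentiableAt one_ne_zero)

theorem differentiableAt_fderiv {f : E → ℝ} {y : E} (hf : ContDiffAt ℝ ∞ f y) :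
    DifferentiableAt ℝ (fderiv ℝ f) y :=
  (hf.fderiv_right (m := 1) (WithTop.coe_le_coe.2 le_top)).differentiableAt one_ne_zero

/-- `u` vanishes to order 3 at `x`: in every chart around `x`, the value and the derivatives of
order 1 and 2 of `u` vanish at `x`. -/
def vanishOrder3 (x : X) : Submodule ℝ (smoothNear I x) where
  carrier := {u | u.1 x = 0 ∧ ∀ e ∈ atlas H X, x ∈ e.source →
    fderiv ℝ (inChart I e u.1) (e.extend I x) = 0 ∧
    fderiv ℝ (fderiv ℝ (inChart I e u.1)) (e.extend I x) = 0}
  add_mem' := by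
    rintro u v ⟨hu0, hu⟩ ⟨hv0, hv⟩
    refine ⟨by simp [hu0, hv0], fun e he hx => ?_⟩
    have cu := contDiffAt_inChart I he hx u.2.self_of_nhds
    have cv := contDiffAt_inChart I he hx v.2.self_of_nhds
    have key := fderiv_add_eventually cu cv
    have heq : inChart I e (u + v).1 = inChart I e u.1 + inChart I e v.1 := rfl
    rw [heq]
    refine ⟨by rw [key.eq_of_nhds, Pi.add_apply, (hu e he hx).1, (hv e he hx).1, add_zero], ?_⟩
    rw [key.fderiv_eq, fderiv_add (differentiableAt_fderiv cu) (differentiableAt_fderiv cv),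
      (hu e he hx).2, (hv e he hx).2, add_zero]
  zero_mem' := by
    refine ⟨rfl, fun e he hx => ?_⟩
    have heq : inChart I e (0 : smoothNear I x).1 = fun _ => 0 := rfl
    rw [heq]
    constructor
    · simp
    · simp [fderiv_fun_const]
  smul_mem' := by
    rintro c u ⟨hu0, hu⟩
    refine ⟨by simp [hu0], fun e he hx => ?_⟩
    have heq : inChart I e (c • u).1 = c • inChart I e u.1 := rfl
    have key : fderiv ℝ (c • inChart I e u.1) = c • fderiv ℝ (inChart I e u.1) :=
      fderiv_const_smul_field c
    rw [heq, key]
    refine ⟨by rw [Pi.smul_apply, (hu e he hx).1, smul_zero], ?_⟩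
    have cu := contDiffAt_inChart I he hx u.2.self_of_nhds
    rw [((differentiableAt_fderiv cu).hasFDerivAt.const_smul c).fderiv, (hu e he hx).2, smul_zero]

/-- The fibre `J²_x = C^∞_x / C^∞_{x,3}` of the 2-jet bundle. -/
def JetFibre (x : X) : Type _ := smoothNear I x ⧸ vanishOrder3 I x

instance (x : X) : AddCommGroup (JetFibre I x) :=
  inferInstanceAs (AddCommGroup (smoothNear I x ⧸ vanishOrder3 I x))

instance (x : X) : Module ℝ (JetFibre I x) :=
  inferInstanceAs (Module ℝ (smoothNear I x ⧸ vanishOrder3 I x))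

/-- The 2-jet at `x` of a function that is smooth near `x`. -/
def jetOf (x : X) (u : smoothNear I x) : JetFibre I x :=
  (Submodule.Quotient.mk u : smoothNear I x ⧸ vanishOrder3 I x)

variable (X) in
/-- The total space of the 2-jet bundle `J²(X)`. -/
structure JetBundle where
  base : X
  jet : JetFibre I base

/-- The jets over the domain of the chart `e` whose coordinates
`(x, u(x), D_x u, D²_x u)` in this chart lie in `O`. -/
def jetBox (e : OpenPartialHomeomorph X H)
    (O : Set (X × ℝ × (E →L[ℝ] ℝ) × (E →L[ℝ] E →L[ℝ] ℝ))) :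
    Set (JetBundle I X) :=
  {J | J.base ∈ e.source ∧ ∃ u : smoothNear I J.base, jetOf I J.base u = J.jet ∧
    (J.base, u.1 J.base, fderiv ℝ (inChart I e u.1) (e.extend I J.base),
      fderiv ℝ (fderiv ℝ (inChart I e u.1)) (e.extend I J.base)) ∈ O}

/-- The topology of the 2-jet bundle: the one that is given by its coordinates in charts. -/
instance : TopologicalSpace (JetBundle I X) :=
  TopologicalSpace.generateFrom
    {W | ∃ e ∈ atlas H X, ∃ O, IsOpen O ∧ W = jetBox I e O}

/-- The fibre has the topology of a subspace of the total space. -/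
instance (x : X) : TopologicalSpace (JetFibre I x) :=
  TopologicalSpace.induced (fun j => (⟨x, j⟩ : JetBundle I X)) inferInstance

/-- The fibre `F_x` of a subset `F ⊂ J²(X)`. -/
def jetSlice (F : Set (JetBundle I X)) (x : X) : Set (JetFibre I x) := {j | ⟨x, j⟩ ∈ F}

/-- The fibre `N_x`: the jets of the constants `s ≤ 0`. -/
def jetNeg (x : X) : Set (JetFibre I x) :=
  {j | ∃ s : ℝ, s ≤ 0 ∧
    j = jetOf I x ⟨fun _ => s, Eventually.of_forall fun _ => contMDiffAt_const⟩}

end Jets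

/-! ### The Riemannian Hessian -/

section Hessian

variable {E : Type*} [NormedAddCommGroup E] [NormedSpace ℝ E] [FiniteDimensional ℝ E]
  {H : Type*} [TopologicalSpace H] {I : ModelWithCorners ℝ E H} [I.Boundaryless]
  {X : Type*} [TopologicalSpace X] [ChartedSpace H X] [IsManifold I ∞ X]
  (g : ContMDiffRiemannianMetric I ∞ E (fun x : X => TangentSpace I x))

theorem exists_sharp (x : X) (l : TangentSpace I x →L[ℝ] ℝ) :
    ∃ z : TangentSpace I x, ∀ w, g.inner x z w = l w := by
  have : FiniteDimensional ℝ (TangentSpace I x) := inferInstanceAs (FiniteDimensional ℝ E)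
  let B : TangentSpace I x →ₗ[ℝ] Module.Dual ℝ (TangentSpace I x) :=
    { toFun := fun v => (g.inner x v).toLinearMap
      map_add' := fun v w => by ext; simp
      map_smul' := fun c v => by ext; simp }
  have hinj : Function.Injective B := by
    rw [← LinearMap.ker_eq_bot, LinearMap.ker_eq_bot']
    intro v hv
    by_contra hne
    have h1 := g.pos x v hne
    have h2 : g.inner x v v = 0 := congrArg (fun f : Module.Dual ℝ (TangentSpace I x) => f v) hv
    exact h1.ne' h2
  have hsurj : Function.Surjective B :=
    (LinearMap.injective_iff_surjective_of_finrank_eq_finrank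
      Subspace.dual_finrank_eq.symm).1 hinj
  obtain ⟨z, hz⟩ := hsurj l.toLinearMap
  exact ⟨z, fun w => congrArg (fun f : Module.Dual ℝ (TangentSpace I x) => f w) hz⟩

/-- The gradient of `u` at `x`: `g(∇u, w) = du(w)` for all `w`. -/
def riemGrad (x : X) (u : X → ℝ) : TangentSpace I x :=
  (exists_sharp g x (mvfderiv I u x)).choose

/-- The coefficient `g(v, w)` of the metric in the chart `e`, for constant coordinate vector
fields `v` and `w`, as a function of the coordinates `y`. -/
def metricCoeff (e : OpenPartialHomeomorph X H) (v w : E) (y : E) : ℝ :=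
  g.inner ((e.extend I).symm y) (mfderiv 𝓘(ℝ, E) I (e.extend I).symm y v)
    (mfderiv 𝓘(ℝ, E) I (e.extend I).symm y w)

/-- The Christoffel symbols of the first kind of the Levi-Civita connection in the chart `e`:
`g(∇_v w, z) = (∂_v g(w, z) + ∂_w g(v, z) - ∂_z g(v, w)) / 2` for constant coordinate vector
fields `v`, `w` and `z`. -/
def christoffel (e : OpenPartialHomeomorph X H) (v w z : E) (y : E) : ℝ :=
  (fderiv ℝ (metricCoeff g e w z) y v + fderiv ℝ (metricCoeff g e v z) y w
    - fderiv ℝ (metricCoeff g e v w) y z) / 2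

/-- The coordinates in the chart `e` of a tangent vector at `x`. -/
def vecInChart (e : OpenPartialHomeomorph X H) (x : X) (v : TangentSpace I x) : E :=
  mfderiv I 𝓘(ℝ, E) (e.extend I) x v

/-- The Riemannian Hessian `(Hess u)(v, w) = v(w u) - (∇_v w) u` at `x`, where `∇` is the
Levi-Civita connection. It is computed with the constant extensions of `v` and `w` in the
preferred chart at `x`, so that `v(w u)` is the second derivative of `u` in the chart and
`(∇_v w) u = g(∇_v w, ∇u)` is given by the Christoffel symbols. -/
def riemHess (x : X) (u : X → ℝ) (v w : TangentSpace I x) : ℝ :=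
  let e := chartAt H x
  fderiv ℝ (fderiv ℝ (inChart I e u)) (e.extend I x) (vecInChart e x v) (vecInChart e x w)
    - christoffel g e (vecInChart e x v) (vecInChart e x w) (vecInChart e x (riemGrad g x u))
        (e.extend I x)

theorem riemHess_symm (x : X) {u : X → ℝ} (hu : ContMDiffAt I 𝓘(ℝ, ℝ) ∞ u x)
    (v w : TangentSpace I x) : riemHess g x u v w = riemHess g x u w v := by
  have hc := contDiffAt_inChart I (chart_mem_atlas H x) (mem_chart_source H x) hu
  have hs := hc.isSymmSndFDerivAt (by
    rw [minSmoothness_of_isRCLikeNormedField]; exact WithTop.coe_le_coe.2 le_top)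
  have hm : ∀ v w : E, metricCoeff g (chartAt H x) v w = metricCoeff g (chartAt H x) w v :=
    fun v w => funext fun y => g.symm _ _ _
  simp only [riemHess, christoffel]
  rw [hs.eq, hm (vecInChart (chartAt H x) x v) (vecInChart (chartAt H x) x w)]
  ring

theorem mvfderiv_eq_of_inChart {x : X} {u v : X → ℝ} (hu : ContMDiffAt I 𝓘(ℝ, ℝ) ∞ u x)
    (hv : ContMDiffAt I 𝓘(ℝ, ℝ) ∞ v x)
    (h : fderiv ℝ (inChart I (chartAt H x) u) ((chartAt H x).extend I x) =
      fderiv ℝ (inChart I (chartAt H x) v) ((chartAt H x).extend I x)) :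
    mvfderiv I u x = mvfderiv I v x := by
  have h1 : MDifferentiableAt I 𝓘(ℝ, ℝ) u x := hu.mdifferentiableAt (by simp)
  have h2 : MDifferentiableAt I 𝓘(ℝ, ℝ) v x := hv.mdifferentiableAt (by simp)
  ext z
  have h3 := congrArg (fun f : E →L[ℝ] ℝ => f z) h
  simpa [mvfderiv, mfderiv, h1, h2, I.range_eq_univ, fderivWithin_univ] using! h3

/-- Two functions with the same 2-jet have the same Taylor coefficients. -/
theorem taylor_eq_of_jet_eq {x : X} {u v : smoothNear I x} (h : u - v ∈ vanishOrder3 I x) :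
    u.1 x = v.1 x ∧ ∀ e ∈ atlas H X, x ∈ e.source →
      fderiv ℝ (inChart I e u.1) (e.extend I x) = fderiv ℝ (inChart I e v.1) (e.extend I x) ∧
      fderiv ℝ (fderiv ℝ (inChart I e u.1)) (e.extend I x) =
        fderiv ℝ (fderiv ℝ (inChart I e v.1)) (e.extend I x) := by
  obtain ⟨h0, h⟩ := h
  refine ⟨sub_eq_zero.1 h0, fun e he hx => ?_⟩
  have cw := contDiffAt_inChart I he hx (u - v).2.self_of_nhds
  have cv := contDiffAt_inChart I he hx v.2.self_of_nhds
  have key := fderiv_add_eventually cw cv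
  have heq : inChart I e u.1 = inChart I e (u - v).1 + inChart I e v.1 := by
    funext y
    simp [inChart]
  rw [heq]
  refine ⟨by rw [key.eq_of_nhds, Pi.add_apply, (h e he hx).1, zero_add], ?_⟩
  rw [key.fderiv_eq, fderiv_add (differentiableAt_fderiv cw) (differentiableAt_fderiv cv),
    (h e he hx).2, zero_add]

/-- `(u(x), e(u), (Hess u)(e, e))` for a basis `e` of the tangent space at `x`. -/
def frameJetFun {m : ℕ} (x : X) (b : Fin m → TangentSpace I x) (u : smoothNear I x) :
    EuclJet m :=
  (u.1 x, fun i => mvfderiv I u.1 x (b i),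
    ⟨Matrix.of fun i j => riemHess g x u.1 (b i) (b j),
      Matrix.IsSymm.ext fun i j => riemHess_symm g x u.2.self_of_nhds (b j) (b i)⟩)

/-- The trivialization `Φᵉ : J²_x → ℝ × ℝᵐ × Sym²(ℝᵐ)` that is determined by a basis `e` of
the tangent space at `x`. -/
def frameJet {m : ℕ} (x : X) (b : Fin m → TangentSpace I x) (j : JetFibre I x) : EuclJet m :=
  Quotient.liftOn' j (frameJetFun g x b) fun u v huv => by
    have h := taylor_eq_of_jet_eq ((Submodule.quotientRel_def _).1 huv)
    have h' := h.2 _ (chart_mem_atlas H x) (mem_chart_source H x)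
    have hd := mvfderiv_eq_of_inChart u.2.self_of_nhds v.2.self_of_nhds h'.1
    have hH : ∀ a b, riemHess g x u.1 a b = riemHess g x v.1 a b := by
      intro a b
      simp only [riemHess, riemGrad, h'.2, hd]
    simp only [frameJetFun, h.1, hd, hH]

/-- The fibre `P_x` of nonnegative elements of `Sym²(T_x^*X) ⊂ J²_x`: the jets of functions with
`u(x) = 0`, `(du)_x = 0` and `Hess_x u ≥ 0`. -/
def jetPos (x : X) : Set (JetFibre I x) :=
  {j | ∃ u : smoothNear I x, j = jetOf I x u ∧ u.1 x = 0 ∧ mvfderiv I u.1 x = 0 ∧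
    ∀ v, 0 ≤ riemHess g x u.1 v v}

/-- A subequation on `X`: a subset of `J²(X)` with the properties
(P) `F + P ⊂ F`, (N) `F + N ⊂ F`, and
(T) `F = closure (Int F)`, `F_x = closure (Int F_x)` and `Int F_x = (Int F)_x`. -/
structure IsSubequation (F : Set (JetBundle I X)) : Prop where
  pos : ∀ x, jetSlice I F x + jetPos g x ⊆ jetSlice I F x
  neg : ∀ x, jetSlice I F x + jetNeg I x ⊆ jetSlice I F x
  top_total : F = closure (interior F)
  top_fibre : ∀ x, jetSlice I F x = closure (interior (jetSlice I F x))
  interior_fibre : ∀ x, interior (jetSlice I F x) = jetSlice I (interior F) x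

end Hessian

/-! ### Topological `G`-structures and Riemannian `G`-subequations -/

section GStructure

variable {E : Type*} [NormedAddCommGroup E] [NormedSpace ℝ E] [FiniteDimensional ℝ E]
  {H : Type*} [TopologicalSpace H] (I : ModelWithCorners ℝ E H) [I.Boundaryless]
  (X : Type*) [TopologicalSpace X] [ChartedSpace H X] [IsManifold I ∞ X]

/-- A smooth frame of `TX` over an open set, that is, a smooth local trivialization of `TX`. -/
structure TangentFrame (m : ℕ) where
  domain : Set X
  isOpen_domain : IsOpen domain
  vec : Fin m → ∀ x : X, TangentSpace I x
  isFrame : IsLocalFrameOn I E ∞ vec domain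

variable {I X}

/-- A topological `G`-structure: smooth frames over the sets of a covering of `X`, any two of
which are related by a `G`-valued function on the intersection of their domains. -/
structure IsTopologicalGStructure {m : ℕ} (G : Subgroup (Matrix.orthogonalGroup (Fin m) ℝ))
    (𝒜 : Set (TangentFrame I X m)) : Prop where
  covers : ∀ x, ∃ e ∈ 𝒜, x ∈ e.domain
  transition : ∀ e ∈ 𝒜, ∀ e' ∈ 𝒜, ∀ x ∈ e.domain ∩ e'.domain, ∃ h ∈ G, ∀ i,
    e'.vec i x = ∑ j, (h : Matrix (Fin m) (Fin m) ℝ) i j • e.vec j x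

/-- `F ⊂ J²(X)` is the Riemannian `G`-subequation on `X` with Euclidean model `𝐅`, for the
topological `G`-structure `𝒜` on `X`: it is a subequation, `G` is contained in the compact
invariance group of the Euclidean subequation `𝐅`, and for every admissible frame `e`
at `x`, a jet `J` at `x` lies in `F_x` if and only if `Φᵉ(J)` lies in `𝐅`. -/
structure IsRiemannianGSubequation
    (g : ContMDiffRiemannianMetric I ∞ E (fun x : X => TangentSpace I x)) {m : ℕ}
    (G : Subgroup (Matrix.orthogonalGroup (Fin m) ℝ)) (𝒜 : Set (TangentFrame I X m))
    (Fmodel : Set (EuclJet m)) (F : Set (JetBundle I X)) : Prop where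
  gStructure : IsTopologicalGStructure G 𝒜
  model : IsEuclSubequation Fmodel
  invariant : G ≤ invarianceGroup Fmodel
  subequation : IsSubequation g F
  mem_iff : ∀ e ∈ 𝒜, ∀ x ∈ e.domain, ∀ j : JetFibre I x,
    (⟨x, j⟩ : JetBundle I X) ∈ F ↔ frameJet g x (fun i => e.vec i x) j ∈ Fmodel

end GStructure

/-! ### The Riemannian product `ℝ × M` -/

section Product

variable {E : Type*} [NormedAddCommGroup E] [NormedSpace ℝ E] [FiniteDimensional ℝ E]
  {H : Type*} [TopologicalSpace H] {I : ModelWithCorners ℝ E H}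
  {M : Type*} [TopologicalSpace M] [ChartedSpace H M] [IsManifold I ∞ M]

theorem contMDiffAt_bilin_of_apply 
    {EX HX X : Type*} [NormedAddCommGroup EX] [NormedSpace ℝ EX]
    [TopologicalSpace HX] {J : ModelWithCorners ℝ EX HX} [TopologicalSpace X] [ChartedSpace HX X]
    (f : X → E →L[ℝ] E →L[ℝ] ℝ) (x : X)
    (h : ∀ v w, ContMDiffAt J 𝓘(ℝ, ℝ) ∞ (fun y => f y v w) x) :
    ContMDiffAt J 𝓘(ℝ, E →L[ℝ] E →L[ℝ] ℝ) ∞ f x := by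
  let b := Module.finBasis ℝ E
  let c := fun i => (b.coord i).toContinuousLinearMap
  have key : f = fun y => ∑ i, ∑ j, (f y (b i) (b j)) • (c i).smulRight (c j) := by
    funext y
    ext v w
    have hv : f y v w = ∑ i, ∑ j, (b.repr v i * b.repr w j) * f y (b i) (b j) := by
      conv_lhs => rw [← b.sum_repr v, ← b.sum_repr w]
      simp only [map_sum, map_smul, _root_.sum_apply, _root_.smul_apply,
        smul_eq_mul, Finset.mul_sum, mul_assoc]
      rw [Finset.sum_comm]
      exact Finset.sum_congr rfl fun i _ => Finset.sum_congr rfl fun j _ => by ring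
    rw [hv]
    simp only [_root_.sum_apply, _root_.smul_apply,
      ContinuousLinearMap.smulRight_apply, c, LinearMap.coe_toContinuousLinearMap',
      Module.Basis.coord_apply, smul_eq_mul]
    exact Finset.sum_congr rfl fun i _ => Finset.sum_congr rfl fun j _ => mul_comm _ _
  rw [key]
  refine ContMDiffAt.sum fun i _ => ContMDiffAt.sum fun j _ => ?_
  exact (h _ _).smul contMDiffAt_const

theorem contMDiff_bilinSection_of_apply (B : ∀ x : M, TangentSpace I x →L[ℝ] TangentSpace I x →L[ℝ] ℝ)
    (h : ∀ (x : M) (s t : ∀ y : M, TangentSpace I y),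
      ContMDiffAt I I.tangent ∞ (fun y => (TotalSpace.mk' E y (s y) : TangentBundle I M)) x →
      ContMDiffAt I I.tangent ∞ (fun y => (TotalSpace.mk' E y (t y) : TangentBundle I M)) x →
      ContMDiffAt I 𝓘(ℝ, ℝ) ∞ (fun y => B y (s y) (t y)) x) :
    ContMDiff I (I.prod 𝓘(ℝ, E →L[ℝ] E →L[ℝ] ℝ)) ∞
      (fun x => TotalSpace.mk' (E →L[ℝ] E →L[ℝ] ℝ)
        (E := fun x : M => TangentSpace I x →L[ℝ] TangentSpace I x →L[ℝ] ℝ) x (B x)) := by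
  intro x
  rw [contMDiffAt_section]
  refine contMDiffAt_bilin_of_apply _ _ fun v w => ?_
  let e := trivializationAt E (TangentSpace I) x
  have hx : e.baseSet ∈ 𝓝 x := e.open_baseSet.mem_nhds (mem_baseSet_trivializationAt E _ x)
  have hs : ∀ v : E, ContMDiffAt I I.tangent ∞
      (fun y => (TotalSpace.mk' E y (e.symm y v) : TangentBundle I M)) x := by
    intro v
    have := e.contMDiffOn_symm (IB := I) (n := ∞)
    refine ((this.comp (s := e.baseSet) (f := fun y => (y, v)) ?_ ?_).congr ?_).contMDiffAt hx
    · exact (contMDiff_id.prodMk contMDiff_const).contMDiffOn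
    · intro y hy; exact e.mem_target.2 hy
    · intro y hy; simp [e.mk_symm hy]
  refine (h x _ _ (hs v) (hs w)).congr_of_eventuallyEq ?_
  filter_upwards [hx] with y hy
  rw [hom_trivializationAt_apply]
  have h3 : y ∈ (trivializationAt ℝ (Bundle.Trivial M ℝ) x).baseSet := Set.mem_univ y
  refine (inCoordinates_apply_eq₂ (𝕜 := ℝ) (E₃ := Bundle.Trivial M ℝ) (ϕ := B y) hy hy h3).trans ?_
  rw [Trivialization.coe_linearMapAt_of_mem _ h3]
  rfl

/-- The components of a smooth vector field on `ℝ × M` are smooth. -/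
theorem contMDiff_sections_prod (s : ∀ p : ℝ × M, TangentSpace (𝓘(ℝ, ℝ).prod I) p) (p : ℝ × M)
    (hs : ContMDiffAt (𝓘(ℝ, ℝ).prod I) (𝓘(ℝ, ℝ).prod I).tangent ∞
      (fun y => (TotalSpace.mk' (ℝ × E) y (s y) : TangentBundle (𝓘(ℝ, ℝ).prod I) (ℝ × M))) p) :
    ContMDiffAt (𝓘(ℝ, ℝ).prod I) 𝓘(ℝ, ℝ) ∞ (fun q => mfderiv (𝓘(ℝ, ℝ).prod I) 𝓘(ℝ, ℝ) Prod.fst q (s q) : ℝ × M → ℝ) p ∧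
    ContMDiffAt (𝓘(ℝ, ℝ).prod I) I.tangent ∞
      (fun q => (TotalSpace.mk' E q.2 (mfderiv (𝓘(ℝ, ℝ).prod I) I Prod.snd q (s q)) : TangentBundle I M)) p := by
  have h1 := (ContMDiff.contMDiff_tangentMap (contMDiff_fst (I := 𝓘(ℝ, ℝ)) (J := I) (M := ℝ) (N := M) (n := ∞)) (m := ∞) le_rfl)
  have h2 := (ContMDiff.contMDiff_tangentMap (contMDiff_snd (I := 𝓘(ℝ, ℝ)) (J := I) (M := ℝ) (N := M) (n := ∞)) (m := ∞) le_rfl)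
  refine ⟨?_, (h2.contMDiffAt.comp p hs)⟩
  have h3 := h1.contMDiffAt.comp p hs
  have h4 := (contMDiffAt_totalSpace.1 h3).2
  refine h4.congr_of_eventuallyEq ?_
  filter_upwards with q
  simp [tangentMap]
  rfl

/-- The product metric `dt² + g` at `p`. -/
def prodInner (g : ContMDiffRiemannianMetric I ∞ E (fun x : M => TangentSpace I x)) (p : ℝ × M) :
    TangentSpace (𝓘(ℝ, ℝ).prod I) p →L[ℝ] TangentSpace (𝓘(ℝ, ℝ).prod I) p →L[ℝ] ℝ :=
  ((ContinuousLinearMap.mul ℝ ℝ).bilinearComp (ContinuousLinearMap.fst ℝ ℝ E)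
      (ContinuousLinearMap.fst ℝ ℝ E) +
     (show E →L[ℝ] E →L[ℝ] ℝ from g.inner p.2).bilinearComp (ContinuousLinearMap.snd ℝ ℝ E)
      (ContinuousLinearMap.snd ℝ ℝ E) : (ℝ × E) →L[ℝ] (ℝ × E) →L[ℝ] ℝ)

theorem prodInner_apply (g : ContMDiffRiemannianMetric I ∞ E (fun x : M => TangentSpace I x))
    (p : ℝ × M) (v w : ℝ × E) :
    prodInner g p v w = v.1 * w.1 + g.inner p.2 v.2 w.2 := rfl

/-- The product metric `dt² + g` on `ℝ × M`. -/
def prodMetric (g : ContMDiffRiemannianMetric I ∞ E (fun x : M => TangentSpace I x)) :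
    ContMDiffRiemannianMetric (𝓘(ℝ, ℝ).prod I) ∞ (ℝ × E)
      (fun p : ℝ × M => TangentSpace (𝓘(ℝ, ℝ).prod I) p) where
  inner := prodInner g
  symm p v w := by
    rw [prodInner_apply g p v w, prodInner_apply g p w v, mul_comm]
    exact congrArg _ (g.symm p.2 _ _)
  pos p v hv := by
    have key : ∀ w : ℝ × E, w ≠ 0 → 0 < w.1 * w.1 + g.inner p.2 w.2 w.2 := by
      rintro ⟨a, w⟩ hw
      have hg : w ≠ 0 → 0 < g.inner p.2 w w := g.pos p.2 w
      by_cases h : w = 0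
      · have ha : a ≠ 0 := by rintro rfl; exact hw (by simp [h])
        have h0 : g.inner p.2 w w = 0 := by
          rw [h]; exact (g.inner p.2 (0 : E)).map_zero
        rw [h0, add_zero]
        exact mul_self_pos.2 ha
      · exact add_pos_of_nonneg_of_pos (mul_self_nonneg a) (hg h)
    exact key v hv
  isVonNBounded p := by
    have h2 : Bornology.IsBounded {w : E | g.inner p.2 w w < 1} :=
      (NormedSpace.isVonNBounded_iff ℝ).1 (g.isVonNBounded p.2)
    have h1 : Bornology.IsBounded {a : ℝ | a * a < 1} :=
      (Metric.isBounded_Icc (-1 : ℝ) 1).subset fun a (ha : a * a < 1) =>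
        ⟨by nlinarith, by nlinarith⟩
    have h3 : Bornology.IsBounded {v : ℝ × E | v.1 * v.1 + g.inner p.2 v.2 v.2 < 1} := by
      refine (h1.prod h2).subset ?_
      rintro ⟨a, w⟩ (hw : a * a + g.inner p.2 w w < 1)
      have hg : 0 ≤ g.inner p.2 w w := by
        by_cases h : w = 0
        · rw [h]; exact ((g.inner p.2 (0 : E)).map_zero).ge
        · exact (g.pos p.2 w h).le
      exact ⟨by change a * a < 1; linarith, by
        change g.inner p.2 w w < 1; linarith [mul_self_nonneg a]⟩
    exact (NormedSpace.isVonNBounded_iff ℝ).2 h3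
  contMDiff := by
    refine contMDiff_bilinSection_of_apply _ ?_
    intro p s t hs ht
    have hs' := contMDiff_sections_prod s p hs
    have ht' := contMDiff_sections_prod t p ht
    have h1 := hs'.1.mul ht'.1
    have h2 := ContMDiffAt.clm_bundle_apply₂ (F₁ := E) (F₂ := E) (F₃ := ℝ) (E₃ := Bundle.Trivial M ℝ) 
      (g.contMDiff.contMDiffAt.comp p contMDiffAt_snd) hs'.2 ht'.2
    have h3 := (contMDiffAt_totalSpace.1 h2).2
    refine (h1.add h3).congr_of_eventuallyEq ?_
    filter_upwards with q
    simp only [mfderiv_fst, mfderiv_snd]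
    rfl

/-- The adapted frames of `ℝ × M`: the smooth local frames `(e_0, e_1, …, e_n)` that are
orthonormal for the product metric and have `e_0 = ∂/∂t`; thus `(e_1, …, e_n)` is an orthonormal
frame of the summand `TM` of `T(ℝ × M) = Tℝ ⊕ TM`. -/
def adaptedFrames {n : ℕ} (g : ContMDiffRiemannianMetric I ∞ E (fun x : M => TangentSpace I x)) :
    Set (TangentFrame (𝓘(ℝ, ℝ).prod I) (ℝ × M) (n + 1)) :=
  {e | ∀ p ∈ e.domain, e.vec 0 p = ((1, 0) : ℝ × E) ∧
    ∀ i j, (prodMetric g).inner p (e.vec i p) (e.vec j p) = if i = j then 1 else 0}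

end Product

end

set_option linter.unusedSectionVars false

noncomputable section

/-! ### Continuity of spectral sums -/

section SpectralSum

open Polynomial

theorem exists_roots_vector {m : ℕ} (Z : Matrix (Fin m) (Fin m) ℂ) :
    ∃ r : Fin m → ℂ, Finset.univ.val.map r = Z.charpoly.roots := by
  have hcard : Z.charpoly.roots.card = m := by
    rw [← (IsAlgClosed.splits Z.charpoly).natDegree_eq_card_roots, Z.charpoly_natDegree_eq_dim,
      Fintype.card_fin]
  have hl : Z.charpoly.roots.toList.length = m := by simpa using hcard
  refine ⟨fun i => Z.charpoly.roots.toList.get (i.cast hl.symm), ?_⟩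
  have h1 : (Finset.univ : Finset (Fin m)).val.map
      (fun i => Z.charpoly.roots.toList.get (i.cast hl.symm)) =
      ((List.ofFn fun i : Fin m => Z.charpoly.roots.toList.get (i.cast hl.symm)) : Multiset ℂ) := by
    simp [Fin.univ_val_map]
  rw [h1]
  conv_rhs => rw [← Multiset.coe_toList Z.charpoly.roots]
  congr 1
  refine List.ext_getElem (by simp [hl]) fun i h1 h2 => by simp

/-- The eigenvalues of a matrix with multiplicity, in some order. -/
def rootsVector {m : ℕ} (Z : Matrix (Fin m) (Fin m) ℂ) : Fin m → ℂ :=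
  (exists_roots_vector Z).choose

theorem map_rootsVector {m : ℕ} (Z : Matrix (Fin m) (Fin m) ℂ) :
    Finset.univ.val.map (rootsVector Z) = Z.charpoly.roots :=
  (exists_roots_vector Z).choose_spec

theorem charpoly_eq_prod_rootsVector {m : ℕ} (Z : Matrix (Fin m) (Fin m) ℂ) :
    Z.charpoly = ∏ i, (X - C (rootsVector Z i)) := by
  conv_lhs => rw [(IsAlgClosed.splits Z.charpoly).eq_prod_roots_of_monic Z.charpoly_monic]
  rw [← map_rootsVector, Multiset.map_map]
  rfl

theorem isRoot_rootsVector {m : ℕ} (Z : Matrix (Fin m) (Fin m) ℂ) (i : Fin m) :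
    Z.charpoly.IsRoot (rootsVector Z i) := by
  have : rootsVector Z i ∈ Z.charpoly.roots := by
    rw [← map_rootsVector]; exact Multiset.mem_map_of_mem _ (Finset.mem_univ_val i)
  exact (mem_roots'.1 this).2

theorem exists_eigenvector_of_isRoot {m : ℕ} {Z : Matrix (Fin m) (Fin m) ℂ} {l : ℂ}
    (h : Z.charpoly.IsRoot l) : ∃ v : Fin m → ℂ, v ≠ 0 ∧ Z.mulVec v = l • v := by
  have h1 : Module.End.HasEigenvalue (Matrix.toLin' Z) l := by
    rw [Module.End.hasEigenvalue_iff_isRoot_charpoly, Matrix.charpoly_toLin']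
    exact h
  obtain ⟨v, hv⟩ := h1.exists_hasEigenvector
  exact ⟨v, hv.2, by simpa using hv.apply_eq_smul⟩

theorem norm_le_of_isRoot_charpoly {m : ℕ} {Z : Matrix (Fin m) (Fin m) ℂ} {l : ℂ}
    (h : Z.charpoly.IsRoot l) : ‖l‖ ≤ ∑ k, ∑ j, ‖Z k j‖ := by
  obtain ⟨v, hv0, hv⟩ := exists_eigenvector_of_isRoot h
  have hpos : 0 < ‖v‖ := norm_pos_iff.2 hv0
  have hn : ‖l • v‖ ≤ (∑ k, ∑ j, ‖Z k j‖) * ‖v‖ := by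
    rw [← hv]
    refine (pi_norm_le_iff_of_nonneg (by positivity)).2 fun k => ?_
    refine (norm_sum_le Finset.univ fun j => Z k j * v j).trans ?_
    calc ∑ j, ‖Z k j * v j‖ ≤ ∑ j, ‖Z k j‖ * ‖v‖ :=
          Finset.sum_le_sum fun j _ => by
            rw [norm_mul]; exact mul_le_mul_of_nonneg_left (norm_le_pi_norm v j) (norm_nonneg _)
      _ = (∑ j, ‖Z k j‖) * ‖v‖ := by rw [Finset.sum_mul]
      _ ≤ _ := mul_le_mul_of_nonneg_right
          (Finset.single_le_sum (f := fun k => ∑ j, ‖Z k j‖)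
            (fun i _ => Finset.sum_nonneg fun j _ => norm_nonneg _) (Finset.mem_univ k)) hpos.le
  rw [norm_smul] at hn
  exact le_of_mul_le_mul_right hn hpos

/-- A sum over the spectrum depends continuously on the matrix, where the summand is continuous on
the spectrum. -/
theorem continuousAt_sum_roots_charpoly {m : ℕ} {f : ℂ → ℝ} {Z : Matrix (Fin m) (Fin m) ℂ}
    (hf : ∀ l, Z.charpoly.IsRoot l → ContinuousAt f l) :
    ContinuousAt (fun Z : Matrix (Fin m) (Fin m) ℂ => (Z.charpoly.roots.map f).sum) Z := by
  have hsum : ∀ Z : Matrix (Fin m) (Fin m) ℂ,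
      (Z.charpoly.roots.map f).sum = ∑ i, f (rootsVector Z i) := fun Z => by
    rw [← map_rootsVector, Multiset.map_map]; rfl
  refine tendsto_iff_ultrafilter _ _ _ |>.2 fun U hU => ?_
  have hN : Continuous fun Z : Matrix (Fin m) (Fin m) ℂ => ∑ k, ∑ j, ‖Z k j‖ := by fun_prop
  set R := (∑ k, ∑ j, ‖Z k j‖) + 1 with hR
  have hev : ∀ᶠ Y in (U : Filter (Matrix (Fin m) (Fin m) ℂ)), ∑ k, ∑ j, ‖Y k j‖ < R :=
    hU ((hN.tendsto Z).eventually (gt_mem_nhds (by rw [hR]; linarith)))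
  have hcpt : IsCompact (Set.pi univ fun _ : Fin m => Metric.closedBall (0 : ℂ) R) :=
    isCompact_univ_pi fun _ => isCompact_closedBall _ _
  obtain ⟨μ, -, hμ⟩ := hcpt.ultrafilter_le_nhds' (U.map rootsVector) (by
    change ∀ᶠ Y in (U : Filter (Matrix (Fin m) (Fin m) ℂ)), _
    filter_upwards [hev] with Y hY i _
    rw [mem_closedBall_zero_iff]
    exact (norm_le_of_isRoot_charpoly (isRoot_rootsVector Y i)).trans hY.le)
  have hlim : Tendsto rootsVector (U : Filter (Matrix (Fin m) (Fin m) ℂ)) (𝓝 μ) := hμ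
  have hpoly : Z.charpoly = ∏ i, (X - C (μ i)) := by
    refine Polynomial.funext fun x => ?_
    have h1 : Tendsto (fun Y : Matrix (Fin m) (Fin m) ℂ => Y.charpoly.eval x) U
        (𝓝 (Z.charpoly.eval x)) := by
      have hc : Continuous fun Y : Matrix (Fin m) (Fin m) ℂ => Y.charpoly.eval x := by
        simp only [Matrix.eval_charpoly]
        fun_prop
      exact (hc.tendsto Z).mono_left hU
    have h2 : Tendsto (fun Y : Matrix (Fin m) (Fin m) ℂ => Y.charpoly.eval x) U
        (𝓝 ((∏ i, (X - C (μ i))).eval x)) := by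
      simp only [charpoly_eq_prod_rootsVector, eval_prod, eval_sub, eval_X, eval_C]
      exact tendsto_finsetProd _ fun i _ =>
        tendsto_const_nhds.sub ((continuous_apply i).tendsto μ |>.comp hlim)
    exact tendsto_nhds_unique h1 h2
  have hroots : Z.charpoly.roots = Finset.univ.val.map μ := by
    rw [hpoly]
    exact roots_multiset_prod_X_sub_C (Finset.univ.val.map μ) ▸ by
      rw [Multiset.map_map]; rfl
  have hZ : (Z.charpoly.roots.map f).sum = ∑ i, f (μ i) := by
    rw [hroots, Multiset.map_map]; rfl
  simp only [hsum] at hZ ⊢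
  rw [hZ]
  refine tendsto_finsetSum _ fun i _ => ?_
  have hi : Z.charpoly.IsRoot (μ i) := by
    rw [hpoly, IsRoot, eval_prod]
    exact Finset.prod_eq_zero (Finset.mem_univ i) (by simp)
  exact (hf _ hi).tendsto.comp ((continuous_apply i).tendsto μ |>.comp hlim)

/-- The sum of the arguments of the eigenvalues, with multiplicity. -/
def argSum {m : ℕ} (Z : Matrix (Fin m) (Fin m) ℂ) : ℝ := (Z.charpoly.roots.map Complex.arg).sum

theorem continuousAt_argSum {m : ℕ} {Z : Matrix (Fin m) (Fin m) ℂ}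
    (hZ : ∀ l, Z.charpoly.IsRoot l → l ∈ Complex.slitPlane) : ContinuousAt argSum Z :=
  continuousAt_sum_roots_charpoly fun l hl => Complex.continuousAt_arg (hZ l hl)

theorem abs_argSum_le {m : ℕ} (Z : Matrix (Fin m) (Fin m) ℂ) : |argSum Z| ≤ m * Real.pi := by
  have : argSum Z = ∑ i, Complex.arg (rootsVector Z i) := by
    rw [argSum, ← map_rootsVector, Multiset.map_map]; rfl
  rw [this]
  refine (Finset.abs_sum_le_sum_abs _ _).trans ?_
  refine (Finset.sum_le_sum fun i _ => Complex.abs_arg_le_pi _).trans ?_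
  simp

theorem norm_det_mul_exp_argSum {m : ℕ} (Z : Matrix (Fin m) (Fin m) ℂ) :
    (‖Z.det‖ : ℂ) * Complex.exp (argSum Z * Complex.I) = Z.det := by
  have h1 : argSum Z = ∑ i, Complex.arg (rootsVector Z i) := by
    rw [argSum, ← map_rootsVector, Multiset.map_map]; rfl
  have h2 : Z.det = ∏ i, rootsVector Z i := by
    rw [Matrix.det_eq_prod_roots_charpoly, ← map_rootsVector]; rfl
  rw [h1, h2, norm_prod]
  push_cast
  rw [Finset.sum_mul, Complex.exp_sum, ← Finset.prod_mul_distrib]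
  exact Finset.prod_congr rfl fun i _ => Complex.norm_mul_exp_arg_mul_I _

end SpectralSum

/-! ### The matrices `D + √-1 A` -/

section Pencil

open Matrix

variable {m : ℕ}

/-- The complex matrix `D + √-1 A` with `D` diagonal. -/
def pencil (d : Fin m → ℝ) (A : Matrix (Fin m) (Fin m) ℝ) : Matrix (Fin m) (Fin m) ℂ :=
  Matrix.diagonal (fun i => (d i : ℂ)) + Complex.I • A.map Complex.ofReal

theorem continuous_pencil : Continuous fun p : (Fin m → ℝ) × Matrix (Fin m) (Fin m) ℝ =>
    pencil p.1 p.2 := by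
  unfold pencil
  refine Continuous.add (Continuous.matrix_diagonal ?_) (continuous_const.fun_smul
    (Continuous.matrix_map continuous_snd Complex.continuous_ofReal))
  exact continuous_pi fun i => Complex.continuous_ofReal.comp
    ((continuous_apply i).comp continuous_fst)

theorem re_star_dotProduct_pencil_mulVec (d : Fin m → ℝ) {A : Matrix (Fin m) (Fin m) ℝ}
    (hA : A.IsSymm) (v : Fin m → ℂ) :
    (star v ⬝ᵥ (pencil d A).mulVec v).re = ∑ i, d i * Complex.normSq (v i) := by
  have hH : (A.map Complex.ofReal).IsHermitian := by
    ext i j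
    simp [hA.apply]
  have him : (star v ⬝ᵥ (A.map Complex.ofReal).mulVec v).im = 0 :=
    hH.im_star_dotProduct_mulVec_self v
  rw [pencil, Matrix.add_mulVec, dotProduct_add, Matrix.smul_mulVec, dotProduct_smul,
    Complex.add_re, smul_eq_mul, Complex.mul_re, him]
  simp only [Complex.I_re, zero_mul, mul_zero, sub_zero, add_zero, dotProduct, mulVec_diagonal,
    Complex.re_sum]
  refine Finset.sum_congr rfl fun i _ => ?_
  have : star v i * ((d i : ℂ) * v i) = (d i : ℂ) * (Complex.normSq (v i) : ℂ) := by
    rw [Complex.normSq_eq_conj_mul_self]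
    simp only [Pi.star_apply, RCLike.star_def]
    ring
  rw [this, ← Complex.ofReal_mul, Complex.ofReal_re]

theorem re_nonneg_of_isRoot_charpoly_pencil {d : Fin m → ℝ} (hd : ∀ i, 0 ≤ d i)
    {A : Matrix (Fin m) (Fin m) ℝ} (hA : A.IsSymm) {l : ℂ}
    (hl : (pencil d A).charpoly.IsRoot l) : 0 ≤ l.re := by
  obtain ⟨v, hv0, hv⟩ := exists_eigenvector_of_isRoot hl
  have h1 := re_star_dotProduct_pencil_mulVec d hA v
  have h2 : star v ⬝ᵥ v = ((∑ i, Complex.normSq (v i) : ℝ) : ℂ) := by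
    simp [dotProduct, Complex.normSq_eq_conj_mul_self]
  rw [hv, dotProduct_smul, h2, smul_eq_mul, Complex.re_mul_ofReal] at h1
  have h3 : 0 < ∑ i, Complex.normSq (v i) := by
    obtain ⟨i, hi⟩ := Function.ne_iff.1 hv0
    exact Finset.sum_pos' (fun i _ => Complex.normSq_nonneg _)
      ⟨i, Finset.mem_univ i, Complex.normSq_pos.2 hi⟩
  have h4 : 0 ≤ ∑ i, d i * Complex.normSq (v i) :=
    Finset.sum_nonneg fun i _ => mul_nonneg (hd i) (Complex.normSq_nonneg _)
  exact nonneg_of_mul_nonneg_left (h1 ▸ h4) h3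

theorem mem_slitPlane_of_isRoot_charpoly_pencil {d : Fin m → ℝ} (hd : ∀ i, 0 ≤ d i)
    {A : Matrix (Fin m) (Fin m) ℝ} (hA : A.IsSymm) (hdet : (pencil d A).det ≠ 0) {l : ℂ}
    (hl : (pencil d A).charpoly.IsRoot l) : l ∈ Complex.slitPlane := by
  have h1 := re_nonneg_of_isRoot_charpoly_pencil hd hA hl
  have h0 : l ≠ 0 := by
    rintro rfl
    obtain ⟨v, hv0, hv⟩ := exists_eigenvector_of_isRoot hl
    exact hdet (Matrix.exists_mulVec_eq_zero_iff.1 ⟨v, hv0, by simpa using hv⟩)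
  rw [Complex.mem_slitPlane_iff]
  rcases h1.lt_or_eq with h | h
  · exact Or.inl h
  · exact Or.inr fun h' => h0 (Complex.ext h.symm h')

theorem continuousAt_argSum_pencil {d : Fin m → ℝ} (hd : ∀ i, 0 ≤ d i)
    {A : Matrix (Fin m) (Fin m) ℝ} (hA : A.IsSymm) (hdet : (pencil d A).det ≠ 0) :
    ContinuousAt (fun p : (Fin m → ℝ) × Matrix (Fin m) (Fin m) ℝ => argSum (pencil p.1 p.2))
      (d, A) :=
  ContinuousAt.comp (f := fun p : (Fin m → ℝ) × Matrix (Fin m) (Fin m) ℝ => pencil p.1 p.2)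
    (g := argSum)
    (continuousAt_argSum fun _ => mem_slitPlane_of_isRoot_charpoly_pencil hd hA hdet)
    continuous_pencil.continuousAt

theorem sum_mul_normSq_pos {d : Fin m → ℝ} (hd : ∀ i, 0 < d i) {v : Fin m → ℂ} (hv : v ≠ 0) :
    0 < ∑ i, d i * Complex.normSq (v i) := by
  obtain ⟨i, hi⟩ := Function.ne_iff.1 hv
  exact Finset.sum_pos' (fun i _ => mul_nonneg (hd i).le (Complex.normSq_nonneg _))
    ⟨i, Finset.mem_univ i, mul_pos (hd i) (Complex.normSq_pos.2 hi)⟩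

theorem det_pencil_ne_zero {d : Fin m → ℝ} (hd : ∀ i, 0 < d i)
    {A : Matrix (Fin m) (Fin m) ℝ} (hA : A.IsSymm) : (pencil d A).det ≠ 0 := by
  intro h
  obtain ⟨v, hv0, hv⟩ := Matrix.exists_mulVec_eq_zero_iff.2 h
  have h1 := re_star_dotProduct_pencil_mulVec d hA v
  rw [hv, dotProduct_zero, Complex.zero_re] at h1
  exact (sum_mul_normSq_pos hd hv0).ne h1

theorem exists_det_pencil_add_vecMulVec {d : Fin m → ℝ} (hd : ∀ i, 0 < d i)
    {A : Matrix (Fin m) (Fin m) ℝ} (hA : A.IsSymm) {b : Fin m → ℝ} (hb : b ≠ 0) :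
    ∃ q : ℂ, 0 < q.re ∧ ∀ t : ℝ, (pencil d (A + t • vecMulVec b b)).det =
      (pencil d A).det * (1 + t * Complex.I * q) := by
  have hdet := det_pencil_ne_zero hd hA
  set Z := pencil d A with hZ
  set b' : Fin m → ℂ := fun i => (b i : ℂ) with hb'
  set w := Z⁻¹.mulVec b' with hw
  have hZw : Z.mulVec w = b' := by
    rw [hw, Matrix.mulVec_mulVec, Matrix.mul_nonsing_inv _ (isUnit_iff_ne_zero.2 hdet),
      Matrix.one_mulVec]
  have hw0 : w ≠ 0 := by
    intro h
    rw [h, Matrix.mulVec_zero] at hZw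
    refine hb (funext fun i => ?_)
    have := congrFun hZw i
    simp only [hb', Pi.zero_apply] at this
    exact_mod_cast this.symm
  refine ⟨b' ⬝ᵥ w, ?_, fun t => ?_⟩
  · have h1 := re_star_dotProduct_pencil_mulVec d hA w
    rw [← hZ, hZw] at h1
    have h2 : b' ⬝ᵥ w = star (star w ⬝ᵥ b') := by
      rw [← star_dotProduct_star, star_star]
      have : star b' = b' := by
        ext i; simp [hb']
      rw [this]
    rw [h2, Complex.star_def, Complex.conj_re, h1]
    exact sum_mul_normSq_pos hd hw0
  · have h1 : pencil d (A + t • vecMulVec b b) =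
        Z + replicateCol Unit (((t : ℂ) * Complex.I) • b') * replicateRow Unit b' := by
      ext i j
      simp only [hZ, pencil, hb', Matrix.add_apply, Matrix.smul_apply, Matrix.map_apply,
        vecMulVec_apply, Matrix.mul_apply, replicateCol_apply, replicateRow_apply, smul_eq_mul,
        Finset.univ_unique, Finset.sum_singleton, Pi.smul_apply]
      push_cast
      ring
    rw [h1, Matrix.det_add_replicateCol_mul_replicateRow (isUnit_iff_ne_zero.2 hdet)]
    congr 1
    rw [Matrix.det_unique, Matrix.add_apply, Matrix.one_apply_eq, Matrix.mul_assoc]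
    congr 1
    simp only [Matrix.mul_apply, replicateRow_apply, replicateCol_apply, hw, dotProduct, mulVec,
      Pi.smul_apply, smul_eq_mul, Finset.mul_sum]
    exact Finset.sum_congr rfl fun i _ => Finset.sum_congr rfl fun j _ => by ring

theorem argSum_pencil_le_add_vecMulVec {d : Fin m → ℝ} (hd : ∀ i, 0 < d i)
    {A : Matrix (Fin m) (Fin m) ℝ} (hA : A.IsSymm) (b : Fin m → ℝ) :
    argSum (pencil d A) ≤ argSum (pencil d (A + vecMulVec b b)) := by
  by_cases hb : b = 0
  · simp [hb]
  obtain ⟨q, hq, hdet⟩ := exists_det_pencil_add_vecMulVec hd hA hb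
  have hAt : ∀ t : ℝ, (A + t • vecMulVec b b).IsSymm := fun t =>
    hA.add (Matrix.IsSymm.smul (Matrix.IsSymm.ext fun i j => by simp [vecMulVec_apply, mul_comm]) t)
  have him : ∀ t : ℝ, (1 + t * Complex.I * q).im = t * q.re := fun t => by simp
  have hslit : ∀ t ∈ Icc (0 : ℝ) 1, (1 + t * Complex.I * q) ∈ Complex.slitPlane := by
    intro t ht
    rw [Complex.mem_slitPlane_iff, him]
    rcases ht.1.eq_or_lt with h | h
    · left; simp [← h]
    · right; positivity
  set φ : ℝ → ℝ := fun t => argSum (pencil d (A + t • vecMulVec b b)) -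
    Complex.arg (1 + t * Complex.I * q) - argSum (pencil d A) with hφ
  have hcont : ContinuousOn φ (Icc 0 1) := by
    refine ((Continuous.continuousOn ?_).sub fun t ht => ContinuousAt.continuousWithinAt ?_).sub
      continuousOn_const
    · rw [continuous_iff_continuousAt]
      intro t
      have hc : Continuous fun t : ℝ => (d, A + t • vecMulVec b b) := by fun_prop
      exact ContinuousAt.comp (f := fun t : ℝ => (d, A + t • vecMulVec b b))
        (continuousAt_argSum_pencil (fun i => (hd i).le) (hAt t) (det_pencil_ne_zero hd (hAt t)))
        hc.continuousAt
    · have hc : Continuous fun t : ℝ => 1 + t * Complex.I * q := by fun_prop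
      exact ContinuousAt.comp (f := fun t : ℝ => 1 + t * Complex.I * q)
        (Complex.continuousAt_arg (hslit t ht)) hc.continuousAt
  have hmaps : MapsTo φ (Icc 0 1) (range fun k : ℤ => (k : ℝ) * (2 * Real.pi)) := by
    intro t ht
    have h1 := norm_det_mul_exp_argSum (pencil d (A + t • vecMulVec b b))
    have h2 := norm_det_mul_exp_argSum (pencil d A)
    have h3 := Complex.norm_mul_exp_arg_mul_I (1 + t * Complex.I * q)
    have hn0 : (‖(pencil d A).det‖ : ℂ) ≠ 0 := by
      exact_mod_cast norm_ne_zero_iff.2 (det_pencil_ne_zero hd hA)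
    have hn1 : (‖1 + t * Complex.I * q‖ : ℂ) ≠ 0 := by
      exact_mod_cast norm_ne_zero_iff.2 (Complex.slitPlane_ne_zero (hslit t ht))
    have h4 : Complex.exp (argSum (pencil d (A + t • vecMulVec b b)) * Complex.I) =
        Complex.exp (argSum (pencil d A) * Complex.I) *
          Complex.exp (Complex.arg (1 + t * Complex.I * q) * Complex.I) := by
      refine mul_left_cancel₀ (mul_ne_zero hn0 hn1) ?_
      calc _ = ((‖(pencil d (A + t • vecMulVec b b)).det‖ : ℝ) : ℂ) *
            Complex.exp (argSum (pencil d (A + t • vecMulVec b b)) * Complex.I) := by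
            rw [hdet, norm_mul]; push_cast; ring
        _ = (pencil d A).det * (1 + t * Complex.I * q) := by rw [h1, hdet]
        _ = _ := by rw [mul_mul_mul_comm, h2, h3]
    rw [← Complex.exp_add, Complex.exp_eq_exp_iff_exists_int] at h4
    obtain ⟨k, hk⟩ := h4
    refine ⟨k, ?_⟩
    have h5 := congrArg Complex.im hk
    simp at h5
    simp only [hφ]
    linarith
  have hdisc : IsDiscrete (range fun k : ℤ => (k : ℝ) * (2 * Real.pi)) := by
    have : (range fun k : ℤ => (k : ℝ) * (2 * Real.pi)) =
        (AddSubgroup.zmultiples (2 * Real.pi) : Set ℝ) := by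
      ext x; simp [AddSubgroup.mem_zmultiples_iff]
    rw [this]
    exact ⟨inferInstanceAs (DiscreteTopology (AddSubgroup.zmultiples (2 * Real.pi)))⟩
  have hconst := isPreconnected_Icc.constant_of_mapsTo hdisc hcont hmaps
    (left_mem_Icc.2 zero_le_one) (right_mem_Icc.2 zero_le_one)
  have harg : 0 ≤ Complex.arg (1 + (1 : ℝ) * Complex.I * q) := by
    rw [Complex.arg_nonneg_iff, him]
    linarith
  simp only [hφ, zero_smul, add_zero, one_smul, Complex.ofReal_zero, zero_mul, Complex.arg_one]
    at hconst
  linarith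

theorem argSum_pencil_mono_of_pos {d : Fin m → ℝ} (hd : ∀ i, 0 < d i)
    {A P : Matrix (Fin m) (Fin m) ℝ} (hA : A.IsSymm) (hP : P.PosSemidef) :
    argSum (pencil d A) ≤ argSum (pencil d (A + P)) := by
  obtain ⟨k, v, rfl⟩ := Matrix.posSemidef_iff_eq_sum_vecMulVec.1 hP
  clear hP
  have key : ∀ s : Finset (Fin k), (A + ∑ i ∈ s, vecMulVec (v i) (star (v i))).IsSymm ∧
      argSum (pencil d A) ≤ argSum (pencil d (A + ∑ i ∈ s, vecMulVec (v i) (star (v i)))) := by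
    intro s
    induction s using Finset.induction_on with
    | empty => simpa using hA
    | insert i s hi ih =>
      have hv : star (v i) = v i := star_trivial _
      rw [Finset.sum_insert hi, add_comm (vecMulVec _ _), ← add_assoc, hv]
      refine ⟨ih.1.add (Matrix.IsSymm.ext fun i j => by simp [vecMulVec_apply, mul_comm]), ?_⟩
      exact ih.2.trans (argSum_pencil_le_add_vecMulVec hd ih.1 (v i))
  exact (key Finset.univ).2

theorem argSum_pencil_mono {d : Fin m → ℝ} (hd : ∀ i, 0 ≤ d i)
    {A P : Matrix (Fin m) (Fin m) ℝ} (hA : A.IsSymm) (hP : P.PosSemidef)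
    (h1 : (pencil d A).det ≠ 0) (h2 : (pencil d (A + P)).det ≠ 0) :
    argSum (pencil d A) ≤ argSum (pencil d (A + P)) := by
  have hPs : P.IsSymm := by simpa using hP.isHermitian
  have hlim : ∀ B : Matrix (Fin m) (Fin m) ℝ, B.IsSymm → (pencil d B).det ≠ 0 →
      Tendsto (fun η : ℝ => argSum (pencil (fun i => d i + η) B)) (𝓝[>] 0)
        (𝓝 (argSum (pencil d B))) := by
    intro B hB hdet
    have hc : Continuous fun η : ℝ => ((fun i => d i + η : Fin m → ℝ), B) := by fun_prop
    have h3 := hc.tendsto 0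
    simp only [add_zero] at h3
    exact ((continuousAt_argSum_pencil hd hB hdet).tendsto.comp h3).mono_left nhdsWithin_le_nhds
  refine le_of_tendsto_of_tendsto (hlim A hA h1) (hlim _ (hA.add hPs) h2) ?_
  filter_upwards [self_mem_nhdsWithin] with η hη
  exact argSum_pencil_mono_of_pos (fun i => add_pos_of_nonneg_of_pos (hd i) hη) hA hP

end Pencil

/-! ### The Euclidean degenerate special Lagrangian subequation: properties -/

section EuclideanModel

open Matrix

variable {n : ℕ}

/-- The diagonal of `I_n`. -/
def dslDiag (n : ℕ) : Fin (n + 1) → ℝ := fun i => if i = 0 then 0 else 1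

theorem dslDiag_nonneg (i : Fin (n + 1)) : 0 ≤ dslDiag n i := by
  unfold dslDiag; split_ifs <;> norm_num

theorem dslMatrix_eq_pencil (A : SymMat (n + 1)) : dslMatrix A = pencil (dslDiag n) A := by
  unfold dslMatrix pencil dslDiag
  congr 2
  funext i
  split_ifs <;> simp

theorem thetaHat_eq_argSum (A : SymMat (n + 1)) : thetaHat A = argSum (pencil (dslDiag n) A) := by
  rw [thetaHat, dslMatrix_eq_pencil]; rfl

theorem det_pencil_dslDiag_ne_zero {A : SymMat (n + 1)} (hA : A ∉ degenerateSet n) :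
    (pencil (dslDiag n) (A : Matrix (Fin (n + 1)) (Fin (n + 1)) ℝ)).det ≠ 0 := by
  intro h
  obtain ⟨v, hv0, hv⟩ := Matrix.exists_mulVec_eq_zero_iff.2 h
  have h1 := re_star_dotProduct_pencil_mulVec (dslDiag n) A.2 v
  rw [hv, dotProduct_zero, Complex.zero_re] at h1
  have h2 := (Finset.sum_eq_zero_iff_of_nonneg fun i _ =>
    mul_nonneg (dslDiag_nonneg i) (Complex.normSq_nonneg (v i))).1 h1.symm
  have hvs : ∀ i, i ≠ 0 → v i = 0 := fun i hi => by
    simpa [dslDiag, hi] using h2 i (Finset.mem_univ i)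
  have hv00 : v 0 ≠ 0 := fun h0 => hv0 (funext fun i => by
    by_cases hi : i = 0
    · rw [hi]; exact h0
    · exact hvs i hi)
  refine hA fun i => ?_
  have h3 : (A : Matrix (Fin (n + 1)) (Fin (n + 1)) ℝ) i 0 = 0 := by
    have h4 := congrFun hv i
    rw [Matrix.mulVec, dotProduct, Finset.sum_eq_single 0 (fun j _ hj => by rw [hvs j hj, mul_zero])
      (by simp)] at h4
    have h5 : pencil (dslDiag n) (A : Matrix (Fin (n + 1)) (Fin (n + 1)) ℝ) i 0 = 0 := by
      simpa [hv00] using h4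
    by_cases hi : i = 0
    · subst hi
      simpa [pencil, dslDiag] using h5
    · simpa [pencil, dslDiag, Matrix.diagonal_apply_ne _ hi] using h5
  exact ⟨(A.2.apply 0 i).symm.trans h3 |> fun h => by simpa using h, h3⟩

theorem continuousAt_thetaHat {A : SymMat (n + 1)} (hA : A ∉ degenerateSet n) :
    ContinuousAt thetaHat A := by
  have h1 := continuousAt_argSum_pencil dslDiag_nonneg A.2 (det_pencil_dslDiag_ne_zero hA)
  have hc : Continuous fun B : SymMat (n + 1) =>
      (dslDiag n, (B : Matrix (Fin (n + 1)) (Fin (n + 1)) ℝ)) :=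
    continuous_const.prodMk continuous_subtype_val
  have h2 := ContinuousAt.comp (f := fun B : SymMat (n + 1) =>
      (dslDiag n, (B : Matrix (Fin (n + 1)) (Fin (n + 1)) ℝ))) h1 hc.continuousAt
  have h3 : (thetaHat : SymMat (n + 1) → ℝ) = fun B : SymMat (n + 1) => argSum (pencil (dslDiag n) B) :=
    funext thetaHat_eq_argSum
  rw [h3]
  exact h2

theorem thetaHat_mono {A B : SymMat (n + 1)} (hA : A ∉ degenerateSet n) (hB : B ∉ degenerateSet n)
    (hAB : ((B - A : SymMat (n + 1)) : Matrix (Fin (n + 1)) (Fin (n + 1)) ℝ).PosSemidef) :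
    thetaHat A ≤ thetaHat B := by
  have h := argSum_pencil_mono dslDiag_nonneg A.2 hAB (det_pencil_dslDiag_ne_zero hA)
  have h1 : (A : Matrix (Fin (n + 1)) (Fin (n + 1)) ℝ) + ((B - A : SymMat (n + 1)) : Matrix (Fin (n + 1)) (Fin (n + 1)) ℝ) =
      B := by simp
  rw [h1] at h
  rw [thetaHat_eq_argSum, thetaHat_eq_argSum]
  exact h (det_pencil_dslDiag_ne_zero hB)

theorem abs_thetaHat_le (A : SymMat (n + 1)) : |thetaHat A| ≤ (n + 1 : ℕ) * Real.pi := by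
  rw [thetaHat_eq_argSum]; exact abs_argSum_le _

/-- The identity, as a symmetric matrix. -/
def symOne (m : ℕ) : SymMat m := ⟨1, Matrix.isSymm_one⟩

theorem posSemidef_smul_symOne {m : ℕ} {δ : ℝ} (hδ : 0 ≤ δ) :
    ((δ • symOne m : SymMat m) : Matrix (Fin m) (Fin m) ℝ).PosSemidef :=
  Matrix.PosSemidef.one.smul hδ

theorem continuous_add_smul_symOne {m : ℕ} (A : SymMat m) :
    Continuous fun δ : ℝ => A + δ • symOne m := by fun_prop

theorem tendsto_add_smul_symOne {m : ℕ} (A : SymMat m) :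
    Tendsto (fun δ : ℝ => A + δ • symOne m) (𝓝[>] 0) (𝓝 A) := by
  have h := (continuous_add_smul_symOne A).tendsto 0
  rw [zero_smul, add_zero] at h
  exact h.mono_left nhdsWithin_le_nhds

theorem continuous_symMat_apply {m : ℕ} (i j : Fin m) :
    Continuous fun A : SymMat m => (A : Matrix (Fin m) (Fin m) ℝ) i j :=
  (continuous_apply j).comp ((continuous_apply i).comp continuous_subtype_val)

theorem eventually_add_smul_symOne_notMem (A : SymMat (n + 1)) :
    ∀ᶠ δ : ℝ in 𝓝[>] 0, A + δ • symOne (n + 1) ∉ degenerateSet n := by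
  have h : ∀ δ : ℝ, A + δ • symOne (n + 1) ∈ degenerateSet n →
      δ = -(A : Matrix (Fin (n + 1)) (Fin (n + 1)) ℝ) 0 0 := by
    intro δ hδ
    have := (hδ 0).1
    simp [symOne] at this
    linarith
  by_cases h0 : (A : Matrix (Fin (n + 1)) (Fin (n + 1)) ℝ) 0 0 = 0
  · filter_upwards [self_mem_nhdsWithin] with δ hδ hmem
    have := h δ hmem
    rw [h0, neg_zero] at this
    exact (ne_of_gt hδ) this
  · have : ∀ᶠ δ : ℝ in 𝓝[>] 0, δ ≠ -(A : Matrix (Fin (n + 1)) (Fin (n + 1)) ℝ) 0 0 :=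
      nhdsWithin_le_nhds (isOpen_ne.mem_nhds (by simpa [eq_comm] using h0))
    exact this.mono fun δ hδ hmem => hδ (h δ hmem)

theorem neBot_nhdsWithin_compl_degenerateSet (A : SymMat (n + 1)) :
    (𝓝[(degenerateSet n)ᶜ] A).NeBot :=
  (tendsto_nhdsWithin_iff.2
    ⟨tendsto_add_smul_symOne A, eventually_add_smul_symOne_notMem A⟩).neBot

/-- The limit superior of `Θ̂` along the complement of the degenerate set. -/
def thetaLimsup (A : SymMat (n + 1)) : ℝ := limsup thetaHat (𝓝[(degenerateSet n)ᶜ] A)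

theorem isBoundedUnder_thetaHat (l : Filter (SymMat (n + 1))) :
    IsBoundedUnder (· ≤ ·) l thetaHat :=
  isBoundedUnder_of ⟨_, fun A => (abs_le.1 (abs_thetaHat_le A)).2⟩

theorem isCoboundedUnder_thetaHat (l : Filter (SymMat (n + 1))) [l.NeBot] :
    IsCoboundedUnder (· ≤ ·) l thetaHat :=
  (isBoundedUnder_of (r := (· ≥ ·))
    ⟨_, fun A => (abs_le.1 (abs_thetaHat_le A)).1⟩).isCoboundedUnder_le

theorem eventually_thetaHat_lt {A : SymMat (n + 1)} {y : ℝ} (h : thetaLimsup A < y) :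
    ∀ᶠ B in 𝓝[(degenerateSet n)ᶜ] A, thetaHat B < y :=
  eventually_lt_of_limsup_lt h (isBoundedUnder_thetaHat _)

theorem thetaLimsup_le {A : SymMat (n + 1)} {y : ℝ}
    (h : ∀ᶠ B in 𝓝[(degenerateSet n)ᶜ] A, thetaHat B ≤ y) : thetaLimsup A ≤ y := by
  have := neBot_nhdsWithin_compl_degenerateSet A
  exact limsup_le_of_le (isCoboundedUnder_thetaHat _) h

theorem thetaLimsup_eq_thetaHat : EqOn thetaLimsup thetaHat (degenerateSet n)ᶜ := by
  intro A hA
  have h : Tendsto thetaHat (𝓝[(degenerateSet n)ᶜ] A) (𝓝 (thetaHat A)) :=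
    (continuousAt_thetaHat hA).tendsto.mono_left nhdsWithin_le_nhds
  have := neBot_nhdsWithin_compl_degenerateSet A
  exact h.limsup_eq

theorem upperSemicontinuous_thetaLimsup :
    UpperSemicontinuous (thetaLimsup : SymMat (n + 1) → ℝ) := by
  intro A y hy
  obtain ⟨r, hr, hry⟩ := exists_between hy
  have h := eventually_thetaHat_lt hr
  rw [← eventually_nhds_nhdsWithin] at h
  exact h.mono fun B hB => (thetaLimsup_le (hB.mono fun _ h => h.le)).trans_lt hry

theorem thetaTilde_eq_thetaLimsup (A : SymMat (n + 1)) : thetaTilde A = thetaLimsup A := by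
  refine IsLeast.csInf_eq ⟨⟨thetaLimsup, upperSemicontinuous_thetaLimsup,
    thetaLimsup_eq_thetaHat, rfl⟩, ?_⟩
  rintro r ⟨f, hf, hfe, rfl⟩
  by_contra! hlt
  obtain ⟨y, hy1, hy2⟩ := exists_between hlt
  refine hy2.not_ge (thetaLimsup_le ?_)
  filter_upwards [nhdsWithin_le_nhds (hf A y hy1), self_mem_nhdsWithin] with B hB hBm
  rw [← hfe hBm]
  exact (show f B < y from hB).le

theorem thetaTilde_mono {A P : SymMat (n + 1)}
    (hP : (P : Matrix (Fin (n + 1)) (Fin (n + 1)) ℝ).PosSemidef) :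
    thetaTilde A ≤ thetaTilde (A + P) := by
  rw [thetaTilde_eq_thetaLimsup, thetaTilde_eq_thetaLimsup]
  refine le_of_forall_gt_imp_ge_of_dense fun y hy => ?_
  have h1 := eventually_nhdsWithin_iff.1 (eventually_thetaHat_lt hy)
  have h2 : Tendsto (fun B : SymMat (n + 1) => B + P) (𝓝 A) (𝓝 (A + P)) :=
    (continuous_id.add continuous_const).tendsto A
  refine thetaLimsup_le ?_
  filter_upwards [nhdsWithin_le_nhds (h2.eventually h1.eventually_nhds), self_mem_nhdsWithin]
    with B hB hBm
  obtain ⟨δ, ⟨hδ1, hδ2⟩, hδ0⟩ := (((tendsto_add_smul_symOne (B + P)).eventually hB).and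
    (eventually_add_smul_symOne_notMem (B + P))).and self_mem_nhdsWithin |>.exists
  refine (thetaHat_mono hBm hδ2 ?_).trans (hδ1 hδ2).le
  have : B + P + δ • symOne (n + 1) - B = P + δ • symOne (n + 1) := by abel
  rw [this]
  exact hP.add (posSemidef_smul_symOne (le_of_lt hδ0))

theorem isClosed_dslSet (c : ℝ) : IsClosed (dslSet n c) := by
  have : dslSet n c = thetaLimsup ⁻¹' Ici c := by
    ext A; simp [dslSet, thetaTilde_eq_thetaLimsup]
  rw [this]
  exact upperSemicontinuous_thetaLimsup.isClosed_preimage c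

theorem dslSet_add_posSemidef {c : ℝ} {A P : SymMat (n + 1)} (hA : A ∈ dslSet n c)
    (hP : (P : Matrix (Fin (n + 1)) (Fin (n + 1)) ℝ).PosSemidef) : A + P ∈ dslSet n c :=
  le_trans (show c ≤ thetaTilde A from hA) (thetaTilde_mono hP)

theorem isClosed_dslJet (c : ℝ) : IsClosed (dslJet n c) :=
  (isClosed_dslSet c).preimage (continuous_snd.comp continuous_snd)

/-- Symmetric matrices near a positive multiple of the identity are nonnegative. -/
theorem eventually_posSemidef_nhds_smul_symOne {m : ℕ} {δ : ℝ} (hδ : 0 < δ) :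
    ∀ᶠ B : SymMat m in 𝓝 (δ • symOne m : SymMat m), (B : Matrix (Fin m) (Fin m) ℝ).PosSemidef := by
  have hc : Continuous fun B : SymMat m =>
      ∑ i, ∑ j, |((B - δ • symOne m : SymMat m) : Matrix (Fin m) (Fin m) ℝ) i j| := by
    refine continuous_finsetSum _ fun i _ => continuous_finsetSum _ fun j _ => ?_
    have h : Continuous fun B : SymMat m => B - δ • symOne m := by fun_prop
    exact ((continuous_symMat_apply i j).comp h).abs
  have h0 := hc.tendsto (δ • symOne m)
  simp only [sub_self, ZeroMemClass.coe_zero, Matrix.zero_apply, abs_zero,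
    Finset.sum_const_zero] at h0
  filter_upwards [h0.eventually (gt_mem_nhds hδ)] with B hB
  refine Matrix.PosSemidef.of_dotProduct_mulVec_nonneg (by
    rw [Matrix.IsHermitian, conjTranspose_eq_transpose_of_trivial]; exact B.2) fun x => ?_
  set E : Matrix (Fin m) (Fin m) ℝ := ((B - δ • symOne m : SymMat m) : Matrix (Fin m) (Fin m) ℝ) with hE
  have hBE : (B : Matrix (Fin m) (Fin m) ℝ) = δ • (1 : Matrix (Fin m) (Fin m) ℝ) + E := by
    simp [hE, symOne]
  rw [hBE, Matrix.add_mulVec, dotProduct_add, Matrix.smul_mulVec, Matrix.one_mulVec,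
    dotProduct_smul, star_trivial]
  have hxx : ∀ i, x i ^ 2 ≤ x ⬝ᵥ x := fun i => by
    rw [dotProduct, sq]
    exact Finset.single_le_sum (f := fun i => x i * x i) (fun i _ => mul_self_nonneg _)
      (Finset.mem_univ i)
  have hbound : |x ⬝ᵥ E.mulVec x| ≤ (∑ i, ∑ j, |E i j|) * (x ⬝ᵥ x) := by
    simp only [dotProduct, mulVec, Finset.mul_sum]
    rw [← Finset.mul_sum, Finset.sum_mul]
    simp only [Finset.sum_mul]
    refine (Finset.abs_sum_le_sum_abs _ _).trans (Finset.sum_le_sum fun i _ => ?_)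
    refine (Finset.abs_sum_le_sum_abs _ _).trans (Finset.sum_le_sum fun j _ => ?_)
    have : |x i * (E i j * x j)| = |E i j| * |x i * x j| := by
      simp only [abs_mul]; ring
    rw [this]
    refine mul_le_mul_of_nonneg_left ?_ (abs_nonneg _)
    have h1 := hxx i
    have h2 := hxx j
    simp only [dotProduct] at h1 h2
    rw [abs_le]
    constructor <;> nlinarith [sq_nonneg (x i + x j), sq_nonneg (x i - x j)]
  have hx0 : 0 ≤ x ⬝ᵥ x := Finset.sum_nonneg fun i _ => mul_self_nonneg _
  have h3 := (abs_le.1 hbound).1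
  have h4 := mul_le_mul_of_nonneg_right hB.le hx0
  simp only [smul_eq_mul]
  linarith

/-- The jet `(0, 0, δ I)`. -/
def scalarJet (m : ℕ) (δ : ℝ) : EuclJet m := (0, 0, δ • symOne m)

theorem continuous_scalarJet (m : ℕ) : Continuous (scalarJet m) := by
  unfold scalarJet; fun_prop

/-- Pushing a point of `ℝ × ℝⁿ⁺¹ × 𝓕_c` in the direction of the identity yields interior points. -/
theorem add_scalarJet_mem_interior_dslJet {c : ℝ} {J : EuclJet (n + 1)} (hJ : J ∈ dslJet n c)
    {δ : ℝ} (hδ : 0 < δ) : J + scalarJet (n + 1) δ ∈ interior (dslJet n c) := by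
  rw [mem_interior_iff_mem_nhds]
  have hc : Continuous fun K : EuclJet (n + 1) => K.2.2 - J.2.2 := by fun_prop
  have h := hc.tendsto (J + scalarJet (n + 1) δ)
  have h0 : (J + scalarJet (n + 1) δ).2.2 - J.2.2 = δ • symOne (n + 1) := by
    simp [scalarJet]
  rw [h0] at h
  filter_upwards [h.eventually (eventually_posSemidef_nhds_smul_symOne hδ)] with K hK
  have h1 := dslSet_add_posSemidef (show J.2.2 ∈ dslSet n c from hJ) hK
  rwa [add_sub_cancel] at h1

theorem isEuclSubequation_dslJet (c : ℝ) : IsEuclSubequation (dslJet n c) where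
  pos := by
    rintro _ ⟨J, hJ, K, hK, rfl⟩
    exact dslSet_add_posSemidef (show J.2.2 ∈ dslSet n c from hJ) hK.2.2
  neg := by
    rintro _ ⟨J, hJ, K, hK, rfl⟩
    change J.2.2 + K.2.2 ∈ dslSet n c
    rw [hK.2, Prod.snd_zero, add_zero]
    exact hJ
  top := by
    refine Subset.antisymm (fun J hJ => ?_) (isClosed_dslJet c).closure_interior_subset
    have h : Tendsto (fun δ => J + scalarJet (n + 1) δ) (𝓝[>] 0) (𝓝 J) := by
      have := ((continuous_const (y := J)).add (continuous_scalarJet (n + 1))).tendsto 0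
      have h0 : scalarJet (n + 1) 0 = 0 := by rw [scalarJet, zero_smul]; rfl
      rw [Pi.add_apply, h0, add_zero] at this
      exact this.mono_left nhdsWithin_le_nhds
    refine mem_closure_of_tendsto h ?_
    filter_upwards [self_mem_nhdsWithin] with δ hδ
    exact add_scalarJet_mem_interior_dslJet hJ hδ

/-! Invariance under `O_n`. -/

/-- Congruence by a matrix, on symmetric matrices. -/
def symConj {m : ℕ} (h : Matrix (Fin m) (Fin m) ℝ) (A : SymMat m) : SymMat m :=
  (jetAct h (0, 0, A)).2.2

theorem coe_symConj {m : ℕ} (h : Matrix (Fin m) (Fin m) ℝ) (A : SymMat m) :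
    (symConj h A : Matrix (Fin m) (Fin m) ℝ) = h * A * h.transpose := rfl

theorem continuous_symConj {m : ℕ} (h : Matrix (Fin m) (Fin m) ℝ) : Continuous (symConj h) := by
  refine Continuous.subtype_mk ?_ _
  exact (continuous_const.matrix_mul continuous_subtype_val).matrix_mul continuous_const

theorem symConj_oneBlock_mem_degenerateSet {h : Matrix (Fin n) (Fin n) ℝ} {A : SymMat (n + 1)}
    (hA : A ∈ degenerateSet n) : symConj (oneBlock h) A ∈ degenerateSet n := by
  have h1 : ∀ i, (symConj (oneBlock h) A : Matrix (Fin (n + 1)) (Fin (n + 1)) ℝ) 0 i = 0 := by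
    intro i
    rw [coe_symConj, Matrix.mul_assoc, Matrix.mul_apply, Fin.sum_univ_succ]
    have h2 : ((A : Matrix (Fin (n + 1)) (Fin (n + 1)) ℝ) * (oneBlock h).transpose) 0 i = 0 := by
      rw [Matrix.mul_apply]
      exact Finset.sum_eq_zero fun j _ => by rw [(hA j).1, zero_mul]
    rw [h2, mul_zero, zero_add]
    exact Finset.sum_eq_zero fun j _ => by simp [oneBlock]
  exact fun i => ⟨h1 i, by rw [← (symConj (oneBlock h) A).2.apply]; exact h1 i⟩

theorem thetaHat_symConj_oneBlock {h : Matrix (Fin n) (Fin n) ℝ}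
    (hh : h * h.transpose = 1) (A : SymMat (n + 1)) :
    thetaHat (symConj (oneBlock h) A) = thetaHat A := by
  set U : Matrix (Fin (n + 1)) (Fin (n + 1)) ℂ := (oneBlock h).map Complex.ofReal with hU
  have hHH : oneBlock h * (oneBlock h).transpose = 1 := by
    rw [← oneBlock_transpose, ← oneBlock_mul, hh, oneBlock_one]
  have hUU : U * U.transpose = 1 := by
    have := congrArg (fun B => B.map Complex.ofRealHom) hHH
    simpa [hU, Matrix.map_mul, Matrix.transpose_map] using! this
  have hUU' : U.transpose * U = 1 := mul_eq_one_comm.1 hUU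
  have hD : U * Matrix.diagonal (fun i => (dslDiag n i : ℂ)) * U.transpose =
      Matrix.diagonal (fun i => (dslDiag n i : ℂ)) := by
    have hcomm : U * Matrix.diagonal (fun i => (dslDiag n i : ℂ)) =
        Matrix.diagonal (fun i => (dslDiag n i : ℂ)) * U := by
      ext i j
      rw [Matrix.mul_diagonal, Matrix.diagonal_mul, mul_comm]
      refine Fin.cases ?_ (fun i => ?_) i <;> refine Fin.cases ?_ (fun j => ?_) j <;>
        simp [hU, oneBlock, dslDiag]
    rw [hcomm, Matrix.mul_assoc, hUU, Matrix.mul_one]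
  have hpen : pencil (dslDiag n) (symConj (oneBlock h) A) =
      U * pencil (dslDiag n) A * U.transpose := by
    have hmap : ((symConj (oneBlock h) A : Matrix (Fin (n + 1)) (Fin (n + 1)) ℝ)).map
        Complex.ofReal = U * (A : Matrix (Fin (n + 1)) (Fin (n + 1)) ℝ).map Complex.ofReal *
          U.transpose := by
      rw [coe_symConj]
      have : ∀ B : Matrix (Fin (n + 1)) (Fin (n + 1)) ℝ,
        B.map Complex.ofReal = B.map Complex.ofRealHom := fun _ => rfl
      rw [this, Matrix.map_mul, Matrix.map_mul]
      rfl
    rw [pencil, pencil, Matrix.mul_add, Matrix.add_mul, hD, hmap, Matrix.mul_smul, Matrix.smul_mul]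
  rw [thetaHat_eq_argSum, thetaHat_eq_argSum, hpen, argSum, argSum]
  congr 3
  rw [Matrix.charpoly_mul_comm, ← mul_assoc, hUU', one_mul]

theorem symConj_transpose_symConj {m : ℕ} {h : Matrix (Fin m) (Fin m) ℝ}
    (hh : h.transpose * h = 1) (A : SymMat m) : symConj h.transpose (symConj h A) = A := by
  have h1 := jetAct_mul h.transpose h (0, 0, A)
  rw [hh, jetAct_one] at h1
  exact (congrArg (fun J : EuclJet m => J.2.2) h1).symm

theorem thetaTilde_le_symConj_oneBlock {h : Matrix (Fin n) (Fin n) ℝ}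
    (hh : h * h.transpose = 1) (A : SymMat (n + 1)) :
    thetaTilde A ≤ thetaTilde (symConj (oneBlock h) A) := by
  have hh' : h.transpose * h = 1 := mul_eq_one_comm.1 hh
  have hinv : ∀ B : SymMat (n + 1), symConj (oneBlock h.transpose) (symConj (oneBlock h) B) = B :=
    fun B => by
      rw [oneBlock_transpose]
      exact symConj_transpose_symConj
        (by rw [← oneBlock_transpose, ← oneBlock_mul, hh', oneBlock_one]) B
  rw [thetaTilde_eq_thetaLimsup, thetaTilde_eq_thetaLimsup]
  refine le_of_forall_gt_imp_ge_of_dense fun y hy => ?_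
  have h1 := eventually_nhdsWithin_iff.1 (eventually_thetaHat_lt hy)
  have h2 := ((continuous_symConj (oneBlock h)).tendsto A).eventually h1
  refine thetaLimsup_le (eventually_nhdsWithin_iff.2 (h2.mono fun B hB hBm => ?_))
  rw [← thetaHat_symConj_oneBlock hh B]
  refine (hB fun hmem => hBm ?_).le
  rw [← hinv B]
  exact symConj_oneBlock_mem_degenerateSet hmem

theorem jetAct_oneBlock_mem_dslJet {c : ℝ} {h : Matrix (Fin n) (Fin n) ℝ}
    (hh : h * h.transpose = 1) {J : EuclJet (n + 1)} (hJ : J ∈ dslJet n c) :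
    jetAct (oneBlock h) J ∈ dslJet n c :=
  le_trans (show c ≤ thetaTilde J.2.2 from hJ) (thetaTilde_le_symConj_oneBlock hh _)

theorem orthogonalBlock_le_invarianceGroup (c : ℝ) :
    orthogonalBlock n ≤ invarianceGroup (dslJet n c) := by
  rintro _ ⟨h, rfl⟩
  have hh : (h : Matrix (Fin n) (Fin n) ℝ) * (h : Matrix (Fin n) (Fin n) ℝ).transpose = 1 :=
    (Matrix.mem_orthogonalGroup_iff (Fin n) ℝ).1 h.2
  have hh' : (h : Matrix (Fin n) (Fin n) ℝ).transpose * (h : Matrix (Fin n) (Fin n) ℝ) = 1 :=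
    mul_eq_one_comm.1 hh
  change jetAct (oneBlock (h : Matrix (Fin n) (Fin n) ℝ)) '' dslJet n c = dslJet n c
  refine Subset.antisymm ?_ fun J hJ => ?_
  · rintro _ ⟨J, hJ, rfl⟩
    exact jetAct_oneBlock_mem_dslJet hh hJ
  · refine ⟨jetAct (oneBlock (h : Matrix (Fin n) (Fin n) ℝ).transpose) J,
      jetAct_oneBlock_mem_dslJet (by simpa using hh') hJ, ?_⟩
    rw [← jetAct_mul, ← oneBlock_mul, hh, oneBlock_one, jetAct_one]

end EuclideanModel

/-! ### Coordinates of vectors and of the metric in a chart -/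

section Coordinates

variable {E : Type*} [NormedAddCommGroup E] [NormedSpace ℝ E] [FiniteDimensional ℝ E]
  {H : Type*} [TopologicalSpace H] {I : ModelWithCorners ℝ E H} [I.Boundaryless]
  {X : Type*} [TopologicalSpace X] [ChartedSpace H X] [IsManifold I ∞ X]
  (g : ContMDiffRiemannianMetric I ∞ E (fun x : X => TangentSpace I x))
  {e : OpenPartialHomeomorph X H}

theorem contMDiffOn_extend_symm_target (he : e ∈ atlas H X) :
    ContMDiffOn 𝓘(ℝ, E) I ∞ (e.extend I).symm (e.extend I).target := by
  rw [e.extend_target']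
  exact contMDiffOn_extend_symm (IsManifold.subset_maximalAtlas (I := I) (n := ∞) he)

theorem contMDiffAt_extend_symm (he : e ∈ atlas H X) {y : E} (hy : y ∈ (e.extend I).target) :
    ContMDiffAt 𝓘(ℝ, E) I ∞ (e.extend I).symm y :=
  (contMDiffOn_extend_symm_target he).contMDiffAt (e.isOpen_extend_target.mem_nhds hy)

theorem contMDiffAt_extend_of_mem_atlas (he : e ∈ atlas H X) {x : X} (hx : x ∈ e.source) :
    ContMDiffAt I 𝓘(ℝ, E) ∞ (e.extend I) x :=
  e.contMDiffAt_extend (IsManifold.subset_maximalAtlas (I := I) (n := ∞) he) hx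

theorem mem_extend_target {x : X} (hx : x ∈ e.source) : e.extend I x ∈ (e.extend I).target :=
  (e.extend I).map_source (by rwa [e.extend_source])

theorem extend_symm_mem_source {y : E} (hy : y ∈ (e.extend I).target) :
    (e.extend I).symm y ∈ e.source := by
  have := (e.extend I).map_target hy
  rwa [e.extend_source] at this

theorem exists_extend_symm_eq {x : X} (hx : x ∈ e.source) :
    ∃ y ∈ (e.extend I).target, (e.extend I).symm y = x :=
  ⟨e.extend I x, mem_extend_target hx, e.extend_left_inv hx⟩

/-- The derivative of the inverse of a chart, between model spaces. -/
def symmDeriv (I : ModelWithCorners ℝ E H) (e : OpenPartialHomeomorph X H) (y : E) : E →L[ℝ] E :=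
  mfderiv 𝓘(ℝ, E) I (e.extend I).symm y

/-- The derivative of a chart, between model spaces. -/
def chartDeriv (I : ModelWithCorners ℝ E H) (e : OpenPartialHomeomorph X H) (x : X) : E →L[ℝ] E :=
  mfderiv I 𝓘(ℝ, E) (e.extend I) x

theorem chartDeriv_symmDeriv (he : e ∈ atlas H X) {y : E} (hy : y ∈ (e.extend I).target) (v : E) :
    chartDeriv I e ((e.extend I).symm y) (symmDeriv I e y v) = v := by
  have h1 : HasMFDerivAt 𝓘(ℝ, E) I (e.extend I).symm y (mfderiv 𝓘(ℝ, E) I (e.extend I).symm y) :=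
    ((contMDiffAt_extend_symm he hy).mdifferentiableAt (by simp)).hasMFDerivAt
  have h2 : HasMFDerivAt I 𝓘(ℝ, E) (e.extend I) ((e.extend I).symm y)
      (mfderiv I 𝓘(ℝ, E) (e.extend I) ((e.extend I).symm y)) :=
    ((contMDiffAt_extend_of_mem_atlas he (extend_symm_mem_source hy)).mdifferentiableAt
      (by simp)).hasMFDerivAt
  have h3 := HasMFDerivAt.comp y h2 h1
  have h4 : HasMFDerivAt 𝓘(ℝ, E) 𝓘(ℝ, E) (e.extend I ∘ (e.extend I).symm) y
      (ContinuousLinearMap.id ℝ (TangentSpace 𝓘(ℝ, E) y)) := by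
    refine (hasMFDerivAt_id y).congr_of_eventuallyEq ?_
    filter_upwards [e.isOpen_extend_target.mem_nhds hy] with z hz using (e.extend I).right_inv hz
  exact congrArg (fun L : E →L[ℝ] E => L v) (hasMFDerivAt_unique h3 h4)

theorem symmDeriv_chartDeriv (he : e ∈ atlas H X) {y : E} (hy : y ∈ (e.extend I).target) (v : E) :
    symmDeriv I e y (chartDeriv I e ((e.extend I).symm y) v) = v := by
  have h1 : Function.Injective (chartDeriv I e ((e.extend I).symm y)) := by
    have hs : Function.Surjective (chartDeriv I e ((e.extend I).symm y)).toLinearMap :=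
      fun w => ⟨symmDeriv I e y w, chartDeriv_symmDeriv he hy w⟩
    exact LinearMap.injective_iff_surjective.2 hs
  exact h1 (chartDeriv_symmDeriv he hy _)

/-- The metric at `x`, on the model space. -/
def innerModel (x : X) : E →L[ℝ] E →L[ℝ] ℝ := g.inner x

theorem innerModel_symm (x : X) (v w : E) : innerModel g x v w = innerModel g x w v :=
  g.symm x v w

/-- The metric in the chart `e`. -/
def metricForm (e : OpenPartialHomeomorph X H) (y : E) : E →L[ℝ] E →L[ℝ] ℝ :=
  (innerModel g ((e.extend I).symm y)).bilinearComp (symmDeriv I e y) (symmDeriv I e y)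

theorem metricForm_apply (y v w : E) : metricForm g e y v w =
    innerModel g ((e.extend I).symm y) (symmDeriv I e y v) (symmDeriv I e y w) := rfl

theorem metricForm_symm (y v w : E) : metricForm g e y v w = metricForm g e y w v :=
  innerModel_symm g _ _ _

theorem metricCoeff_eq (v w : E) : metricCoeff g e v w = fun y => metricForm g e y v w := rfl

theorem contMDiffAt_constSection (v y : E) : ContMDiffAt 𝓘(ℝ, E) 𝓘(ℝ, E).tangent ∞
    (fun z => (TotalSpace.mk' E z v : TangentBundle 𝓘(ℝ, E) E)) y := by
  refine contMDiffAt_totalSpace.2 ⟨contMDiffAt_id, ?_⟩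
  simpa using! contMDiffAt_const

theorem contMDiffAt_symmDeriv_section (he : e ∈ atlas H X) {y : E} (hy : y ∈ (e.extend I).target)
    (v : E) : ContMDiffAt 𝓘(ℝ, E) I.tangent ∞
      (fun z => (TotalSpace.mk' E ((e.extend I).symm z) (symmDeriv I e z v) : TangentBundle I X))
      y := by
  have hopen := e.isOpen_extend_target (I := I)
  have h1 := (contMDiffOn_extend_symm_target (I := I) he).contMDiffOn_tangentMapWithin (m := ∞)
    le_rfl hopen.uniqueMDiffOn
  have h2 := (h1.contMDiffAt (x := (TotalSpace.mk' E y v : TangentBundle 𝓘(ℝ, E) E))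
    ((hopen.preimage (FiberBundle.continuous_proj E _)).mem_nhds hy)).comp y
      (contMDiffAt_constSection v y)
  refine h2.congr_of_eventuallyEq ?_
  filter_upwards [hopen.mem_nhds hy] with z hz
  simp only [Function.comp, tangentMapWithin, symmDeriv]
  rw [mfderivWithin_of_isOpen hopen hz]
  rfl

theorem contDiffAt_metricForm (he : e ∈ atlas H X) {y : E} (hy : y ∈ (e.extend I).target) :
    ContDiffAt ℝ ∞ (metricForm g e) y := by
  rw [← contMDiffAt_iff_contDiffAt]
  refine contMDiffAt_bilin_of_apply _ _ fun v w => ?_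
  have h2 := ContMDiffAt.clm_bundle_apply₂ (F₁ := E) (F₂ := E) (F₃ := ℝ)
    (E₃ := Bundle.Trivial X ℝ)
    (g.contMDiff.contMDiffAt.comp y (contMDiffAt_extend_symm he hy))
    (contMDiffAt_symmDeriv_section he hy v) (contMDiffAt_symmDeriv_section he hy w)
  exact (contMDiffAt_totalSpace.1 h2).2

theorem differentiableAt_metricForm (he : e ∈ atlas H X) {y : E} (hy : y ∈ (e.extend I).target) :
    DifferentiableAt ℝ (metricForm g e) y :=
  (contDiffAt_metricForm g he hy).differentiableAt (by simp)

theorem fderiv_metricCoeff (he : e ∈ atlas H X) {y : E} (hy : y ∈ (e.extend I).target)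
    (v w z : E) : fderiv ℝ (metricCoeff g e v w) y z = fderiv ℝ (metricForm g e) y z v w := by
  have h := (differentiableAt_metricForm g he hy).hasFDerivAt
  have h1 := ((h.clm_apply (hasFDerivAt_const v y)).clm_apply (hasFDerivAt_const w y)).fderiv
  rw [metricCoeff_eq, h1]
  simp

theorem christoffel_eq (he : e ∈ atlas H X) {y : E} (hy : y ∈ (e.extend I).target)
    (v w z : E) : christoffel g e v w z y =
      (fderiv ℝ (metricForm g e) y v w z + fderiv ℝ (metricForm g e) y w v z
        - fderiv ℝ (metricForm g e) y z v w) / 2 := by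
  simp only [christoffel, fderiv_metricCoeff g he hy]

theorem inner_eq_metricForm (he : e ∈ atlas H X) {x : X} (hx : x ∈ e.source)
    (v w : TangentSpace I x) : g.inner x v w =
      metricForm g e (e.extend I x) (vecInChart e x v) (vecInChart e x w) := by
  obtain ⟨y, hy, rfl⟩ := exists_extend_symm_eq (I := I) hx
  rw [(e.extend I).right_inv hy]
  exact (congrArg₂ (fun a b => innerModel g ((e.extend I).symm y) a b)
    (symmDeriv_chartDeriv he hy v) (symmDeriv_chartDeriv he hy w)).symm

theorem mvfderiv_eq_fderiv_inChart (he : e ∈ atlas H X) {x : X} (hx : x ∈ e.source) {u : X → ℝ}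
    (hu : ContMDiffAt I 𝓘(ℝ, ℝ) ∞ u x) (v : TangentSpace I x) :
    mvfderiv I u x v = fderiv ℝ (inChart I e u) (e.extend I x) (vecInChart e x v) := by
  have h1 : HasMFDerivAt I 𝓘(ℝ, E) (e.extend I) x (mfderiv I 𝓘(ℝ, E) (e.extend I) x) :=
    ((contMDiffAt_extend_of_mem_atlas he hx).mdifferentiableAt (by simp)).hasMFDerivAt
  have h2 := (((contDiffAt_inChart I he hx hu).differentiableAt
    (by simp)).hasFDerivAt).hasMFDerivAt
  have h3 := HasMFDerivAt.comp x h2 h1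
  have h4 : HasMFDerivAt I 𝓘(ℝ, ℝ) u x _ := h3.congr_of_eventuallyEq (by
    filter_upwards [e.open_source.mem_nhds hx] with z hz
    simp only [Function.comp, inChart]
    rw [e.extend_left_inv hz])
  have h5 := h4.mfderiv
  rw [mvfderiv, h5]
  rfl

end Coordinates

/-! ### Second derivatives and pullbacks under changes of coordinates -/

section Calculus

variable {E : Type*} [NormedAddCommGroup E] [NormedSpace ℝ E]

theorem fderiv_fderiv_comp {f : E → ℝ} {ψ : E → E} {y : E} (hf : ContDiffAt ℝ ∞ f (ψ y))
    (hψ : ContDiffAt ℝ ∞ ψ y) (v w : E) :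
    fderiv ℝ (fderiv ℝ (f ∘ ψ)) y v w =
      fderiv ℝ (fderiv ℝ f) (ψ y) (fderiv ℝ ψ y v) (fderiv ℝ ψ y w) +
        fderiv ℝ f (ψ y) (fderiv ℝ (fderiv ℝ ψ) y v w) := by
  have hf1 : ∀ᶠ z in 𝓝 y, DifferentiableAt ℝ f (ψ z) := hψ.continuousAt.eventually
    (((hf.of_le (m := 1) (by exact_mod_cast le_top)).eventually (by simp)).mono
      fun z h => h.differentiableAt one_ne_zero)
  have hψ1 : ∀ᶠ z in 𝓝 y, DifferentiableAt ℝ ψ z :=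
    ((hψ.of_le (m := 1) (by exact_mod_cast le_top)).eventually (by simp)).mono
      fun z h => h.differentiableAt one_ne_zero
  have h1 : fderiv ℝ (f ∘ ψ) =ᶠ[𝓝 y] fun z => (fderiv ℝ f (ψ z)).comp (fderiv ℝ ψ z) := by
    filter_upwards [hf1, hψ1] with z h2 h3 using fderiv_comp z h2 h3
  have h4 : HasFDerivAt (fderiv ℝ f) (fderiv ℝ (fderiv ℝ f) (ψ y)) (ψ y) :=
    (differentiableAt_fderiv hf).hasFDerivAt
  have h5 : HasFDerivAt (fderiv ℝ ψ) (fderiv ℝ (fderiv ℝ ψ) y) y :=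
    ((hψ.fderiv_right (m := 1) (WithTop.coe_le_coe.2 le_top)).differentiableAt
      one_ne_zero).hasFDerivAt
  have h6 : HasFDerivAt (fun z => (fderiv ℝ f (ψ z)).comp (fderiv ℝ ψ z)) _ y :=
    (h4.comp y hψ1.self_of_nhds.hasFDerivAt).clm_comp h5
  rw [h1.fderiv_eq, h6.fderiv]
  simp [add_comm]

set_option maxSynthPendingDepth 3 in
theorem fderiv_bilinear_pullback {B B' : E → E →L[ℝ] E →L[ℝ] ℝ} {ψ : E → E} {y : E}
    (hB : DifferentiableAt ℝ B (ψ y)) (hψ : ContDiffAt ℝ ∞ ψ y)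
    (hB' : DifferentiableAt ℝ B' y)
    (h : ∀ᶠ z in 𝓝 y, ∀ v w, B' z v w = B (ψ z) (fderiv ℝ ψ z v) (fderiv ℝ ψ z w)) (z v w : E) :
    fderiv ℝ B' y z v w =
      fderiv ℝ B (ψ y) (fderiv ℝ ψ y z) (fderiv ℝ ψ y v) (fderiv ℝ ψ y w) +
      B (ψ y) (fderiv ℝ (fderiv ℝ ψ) y z v) (fderiv ℝ ψ y w) +
      B (ψ y) (fderiv ℝ ψ y v) (fderiv ℝ (fderiv ℝ ψ) y z w) := by
  have h5 : HasFDerivAt (fderiv ℝ ψ) (fderiv ℝ (fderiv ℝ ψ) y) y :=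
    ((hψ.fderiv_right (m := 1) (WithTop.coe_le_coe.2 le_top)).differentiableAt
      one_ne_zero).hasFDerivAt
  have hψ1 : HasFDerivAt ψ (fderiv ℝ ψ y) y := (hψ.differentiableAt (by simp)).hasFDerivAt
  have h1 : HasFDerivAt (fun z => B' z v w) _ y :=
    (hB'.hasFDerivAt.clm_apply (hasFDerivAt_const v y)).clm_apply (hasFDerivAt_const w y)
  have hBψ : HasFDerivAt (fun z => B (ψ z)) ((fderiv ℝ B (ψ y)).comp (fderiv ℝ ψ y)) y :=
    HasFDerivAt.comp (G := E →L[ℝ] E →L[ℝ] ℝ) y hB.hasFDerivAt hψ1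
  have hv : HasFDerivAt (fun z => fderiv ℝ ψ z v) _ y := h5.clm_apply (hasFDerivAt_const v y)
  have hw : HasFDerivAt (fun z => fderiv ℝ ψ z w) _ y := h5.clm_apply (hasFDerivAt_const w y)
  have h2' : HasFDerivAt (fun z => B (ψ z) (fderiv ℝ ψ z v)) _ y := hBψ.clm_apply hv
  have h2 : HasFDerivAt (fun z => B (ψ z) (fderiv ℝ ψ z v) (fderiv ℝ ψ z w)) _ y :=
    h2'.clm_apply hw
  have h3 : (fun z => B' z v w) =ᶠ[𝓝 y] fun z => B (ψ z) (fderiv ℝ ψ z v) (fderiv ℝ ψ z w) :=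
    h.mono fun z hz => hz v w
  have h4 := congrArg (fun L : E →L[ℝ] ℝ => L z) (h1.unique (h2.congr_of_eventuallyEq h3))
  simp at h4
  linarith

end Calculus

/-! ### The Hessian in an arbitrary chart -/

section Transition

variable {E : Type*} [NormedAddCommGroup E] [NormedSpace ℝ E] [FiniteDimensional ℝ E]
  {H : Type*} [TopologicalSpace H] {I : ModelWithCorners ℝ E H} [I.Boundaryless]
  {X : Type*} [TopologicalSpace X] [ChartedSpace H X] [IsManifold I ∞ X]
  (g : ContMDiffRiemannianMetric I ∞ E (fun x : X => TangentSpace I x))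
  {e e' : OpenPartialHomeomorph X H}

/-- The change of coordinates from the chart `e'` to the chart `e`. -/
def chartTransition (I : ModelWithCorners ℝ E H) (e e' : OpenPartialHomeomorph X H) : E → E :=
  e.extend I ∘ (e'.extend I).symm

theorem contDiffAt_chartTransition (he : e ∈ atlas H X) (he' : e' ∈ atlas H X) {y : E}
    (hy : y ∈ (e'.extend I).target) (hs : (e'.extend I).symm y ∈ e.source) :
    ContDiffAt ℝ ∞ (chartTransition I e e') y := by
  rw [← contMDiffAt_iff_contDiffAt]
  exact (contMDiffAt_extend_of_mem_atlas he hs).comp y (contMDiffAt_extend_symm he' hy)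

theorem eventually_mem_overlap (he' : e' ∈ atlas H X) {y : E}
    (hy : y ∈ (e'.extend I).target) (hs : (e'.extend I).symm y ∈ e.source) :
    ∀ᶠ z in 𝓝 y, z ∈ (e'.extend I).target ∧ (e'.extend I).symm z ∈ e.source :=
  (e'.isOpen_extend_target.eventually_mem hy).and
    ((contMDiffAt_extend_symm he' hy).continuousAt.eventually (e.open_source.eventually_mem hs))

theorem extend_symm_chartTransition {y : E} (hs : (e'.extend I).symm y ∈ e.source) :
    (e.extend I).symm (chartTransition I e e' y) = (e'.extend I).symm y :=
  e.extend_left_inv hs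

theorem symmDeriv_eq_comp (he : e ∈ atlas H X) (he' : e' ∈ atlas H X) {y : E}
    (hy : y ∈ (e'.extend I).target) (hs : (e'.extend I).symm y ∈ e.source) (v : E) :
    symmDeriv I e' y v =
      symmDeriv I e (chartTransition I e e' y) (fderiv ℝ (chartTransition I e e') y v) := by
  have h1 := ((contDiffAt_chartTransition he he' hy hs).differentiableAt
    (by simp)).hasFDerivAt.hasMFDerivAt
  have h2 : HasMFDerivAt 𝓘(ℝ, E) I (e.extend I).symm (chartTransition I e e' y)
      (mfderiv 𝓘(ℝ, E) I (e.extend I).symm (chartTransition I e e' y)) :=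
    ((contMDiffAt_extend_symm he (mem_extend_target hs)).mdifferentiableAt (by simp)).hasMFDerivAt
  have h3 := HasMFDerivAt.comp y h2 h1
  have h4 := h3.congr_of_eventuallyEq (f₁ := (e'.extend I).symm) (by
    filter_upwards [eventually_mem_overlap he' hy hs] with z hz
    exact (extend_symm_chartTransition hz.2).symm)
  exact congrArg (fun L : E →L[ℝ] E => L v) h4.mfderiv

theorem metricForm_eq_pullback (he : e ∈ atlas H X) (he' : e' ∈ atlas H X) {y : E}
    (hy : y ∈ (e'.extend I).target) (hs : (e'.extend I).symm y ∈ e.source) (v w : E) :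
    metricForm g e' y v w = metricForm g e (chartTransition I e e' y)
      (fderiv ℝ (chartTransition I e e') y v) (fderiv ℝ (chartTransition I e e') y w) := by
  rw [metricForm_apply, metricForm_apply, extend_symm_chartTransition hs,
    symmDeriv_eq_comp he he' hy hs, symmDeriv_eq_comp he he' hy hs]

theorem chartDeriv_eq_comp (he : e ∈ atlas H X) (he' : e' ∈ atlas H X) {y : E}
    (hy : y ∈ (e'.extend I).target) (hs : (e'.extend I).symm y ∈ e.source) (v : E) :
    chartDeriv I e ((e'.extend I).symm y) v =
      fderiv ℝ (chartTransition I e e') y (chartDeriv I e' ((e'.extend I).symm y) v) := by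
  have h1 := symmDeriv_chartDeriv (I := I) he' hy v
  rw [symmDeriv_eq_comp he he' hy hs] at h1
  have h2 := chartDeriv_symmDeriv (I := I) he (mem_extend_target hs)
    (fderiv ℝ (chartTransition I e e') y (chartDeriv I e' ((e'.extend I).symm y) v))
  rw [e.extend_left_inv hs] at h2
  exact (congrArg (chartDeriv I e ((e'.extend I).symm y)) h1).symm.trans h2

theorem inChart_eventuallyEq_comp (he' : e' ∈ atlas H X) {y : E}
    (hy : y ∈ (e'.extend I).target) (hs : (e'.extend I).symm y ∈ e.source) (u : X → ℝ) :
    inChart I e' u =ᶠ[𝓝 y] inChart I e u ∘ chartTransition I e e' := by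
  filter_upwards [eventually_mem_overlap he' hy hs] with z hz
  simp only [inChart, Function.comp]
  rw [extend_symm_chartTransition hz.2]

theorem christoffel_transform (he : e ∈ atlas H X) (he' : e' ∈ atlas H X) {y : E}
    (hy : y ∈ (e'.extend I).target) (hs : (e'.extend I).symm y ∈ e.source) (v w z : E) :
    christoffel g e' v w z y =
      christoffel g e (fderiv ℝ (chartTransition I e e') y v)
        (fderiv ℝ (chartTransition I e e') y w) (fderiv ℝ (chartTransition I e e') y z)
        (chartTransition I e e' y) +
      metricForm g e (chartTransition I e e' y)
        (fderiv ℝ (fderiv ℝ (chartTransition I e e')) y v w)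
        (fderiv ℝ (chartTransition I e e') y z) := by
  have hψ := contDiffAt_chartTransition he he' hy hs
  have hy' : chartTransition I e e' y ∈ (e.extend I).target := mem_extend_target hs
  have hsymm : ∀ a b, fderiv ℝ (fderiv ℝ (chartTransition I e e')) y a b =
      fderiv ℝ (fderiv ℝ (chartTransition I e e')) y b a := by
    have := hψ.isSymmSndFDerivAt (by
      rw [minSmoothness_of_isRCLikeNormedField]; exact WithTop.coe_le_coe.2 le_top)
    exact fun a b => this.eq a b
  have key := fderiv_bilinear_pullback (differentiableAt_metricForm g he hy') hψ
    (differentiableAt_metricForm g he' hy)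
    ((eventually_mem_overlap he' hy hs).mono fun z hz => metricForm_eq_pullback g he he' hz.1 hz.2)
  rw [christoffel_eq g he' hy, christoffel_eq g he hy', key, key, key, hsymm w v, hsymm z v,
    hsymm z w, metricForm_symm g _ (fderiv ℝ (chartTransition I e e') y v)
      (fderiv ℝ (fderiv ℝ (chartTransition I e e')) y w z),
    metricForm_symm g _ (fderiv ℝ (chartTransition I e e') y w)
      (fderiv ℝ (fderiv ℝ (chartTransition I e e')) y v z)]
  ring

theorem inner_riemGrad (x : X) (u : X → ℝ) (w : TangentSpace I x) :
    g.inner x (riemGrad g x u) w = mvfderiv I u x w :=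
  (exists_sharp g x (mvfderiv I u x)).choose_spec w

/-- The Hessian, computed in the chart `e`. -/
def hessInChart (e : OpenPartialHomeomorph X H) (x : X) (u : X → ℝ) (v w : TangentSpace I x) : ℝ :=
  fderiv ℝ (fderiv ℝ (inChart I e u)) (e.extend I x) (vecInChart e x v) (vecInChart e x w)
    - christoffel g e (vecInChart e x v) (vecInChart e x w) (vecInChart e x (riemGrad g x u))
        (e.extend I x)

theorem hessInChart_eq (he : e ∈ atlas H X) (he' : e' ∈ atlas H X) {x : X} (hx : x ∈ e.source)
    (hx' : x ∈ e'.source) {u : X → ℝ} (hu : ContMDiffAt I 𝓘(ℝ, ℝ) ∞ u x)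
    (v w : TangentSpace I x) : hessInChart g e' x u v w = hessInChart g e x u v w := by
  obtain ⟨y, hy, rfl⟩ := exists_extend_symm_eq (I := I) hx'
  have hψ := contDiffAt_chartTransition he he' hy hx
  have hcu := contDiffAt_inChart I he hx hu
  set ψ := chartTransition I e e' with hψdef
  have hψy : e.extend I ((e'.extend I).symm y) = ψ y := rfl
  have hvec : ∀ z : TangentSpace I ((e'.extend I).symm y), vecInChart e ((e'.extend I).symm y) z =
      fderiv ℝ ψ y (vecInChart e' ((e'.extend I).symm y) z) := fun z =>
    chartDeriv_eq_comp he he' hy hx z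
  have h2 : fderiv ℝ (fderiv ℝ (inChart I e' u)) y =
      fderiv ℝ (fderiv ℝ (inChart I e u ∘ ψ)) y :=
    (inChart_eventuallyEq_comp he' hy hx u).fderiv.fderiv_eq
  have hgrad : ∀ a : E, metricForm g e (ψ y) a (vecInChart e ((e'.extend I).symm y)
      (riemGrad g ((e'.extend I).symm y) u)) = fderiv ℝ (inChart I e u) (ψ y) a := by
    intro a
    obtain ⟨b, rfl⟩ : ∃ b : TangentSpace I ((e'.extend I).symm y),
        vecInChart e ((e'.extend I).symm y) b = a := by
      refine ⟨symmDeriv I e (ψ y) a, ?_⟩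
      have := chartDeriv_symmDeriv he (mem_extend_target (I := I) hx) a
      rw [e.extend_left_inv hx] at this
      exact this
    rw [metricForm_symm, ← hψy, ← inner_eq_metricForm g he hx, inner_riemGrad,
      mvfderiv_eq_fderiv_inChart he hx hu]
  simp only [hessInChart]
  rw [(e'.extend I).right_inv hy, h2, fderiv_fderiv_comp hcu hψ,
    christoffel_transform g he he' hy hx, ← hψdef, hψy, ← hvec, ← hvec, ← hvec, hgrad]
  ring

theorem riemHess_eq_hessInChart (he : e ∈ atlas H X) {x : X} (hx : x ∈ e.source) {u : X → ℝ}
    (hu : ContMDiffAt I 𝓘(ℝ, ℝ) ∞ u x) (v w : TangentSpace I x) :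
    riemHess g x u v w = hessInChart g e x u v w :=
  hessInChart_eq g he (chart_mem_atlas H x) hx (mem_chart_source H x) hu v w

end Transition

/-! ### Linearity of the Hessian and of frame coordinates of jets -/

section HessianLinear

variable {E : Type*} [NormedAddCommGroup E] [NormedSpace ℝ E] [FiniteDimensional ℝ E]
  {H : Type*} [TopologicalSpace H] {I : ModelWithCorners ℝ E H} [I.Boundaryless]
  {X : Type*} [TopologicalSpace X] [ChartedSpace H X] [IsManifold I ∞ X]
  (g : ContMDiffRiemannianMetric I ∞ E (fun x : X => TangentSpace I x))
  {e : OpenPartialHomeomorph X H} {x : X}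

set_option maxSynthPendingDepth 3 in
theorem exists_christoffel_eq (he : e ∈ atlas H X) {y : E} (hy : y ∈ (e.extend I).target) :
    ∃ T : E →ₗ[ℝ] E →ₗ[ℝ] E →ₗ[ℝ] ℝ, ∀ v w z, christoffel g e v w z y =
      (T v w z + T w v z - T z v w) / 2 := by
  refine ⟨{
    toFun v := (fderiv ℝ (metricForm g e) y v).toLinearMap₁₂
    map_add' v w := ?_
    map_smul' c v := ?_ }, fun v w z => christoffel_eq g he hy v w z⟩
  · rw [ContinuousLinearMap.map_add]
    rfl
  · rw [ContinuousLinearMap.map_smul]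
    rfl

theorem christoffel_sum_smul (he : e ∈ atlas H X) {y : E} (hy : y ∈ (e.extend I).target) {m : ℕ}
    (v w : E) (c : Fin m → ℝ) (z : Fin m → E) : christoffel g e v w (∑ k, c k • z k) y =
      ∑ k, c k * christoffel g e v w (z k) y := by
  obtain ⟨T, hT⟩ := exists_christoffel_eq g he hy
  simp only [hT, map_sum, map_smul, LinearMap.sum_apply, LinearMap.smul_apply, smul_eq_mul,
    ← Finset.sum_add_distrib, ← Finset.sum_sub_distrib, Finset.sum_div]
  exact Finset.sum_congr rfl fun k _ => by ring

theorem eq_of_forall_inner_eq {z z' : TangentSpace I x}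
    (h : ∀ w, g.inner x z w = g.inner x z' w) : z = z' := by
  by_contra hne
  have h1 := g.pos x (z - z') (sub_ne_zero.2 hne)
  have h2 : g.inner x (z - z') (z - z') = 0 := by
    rw [map_sub (g.inner x), sub_apply, h, sub_self]
  exact h1.ne' h2

theorem mvfderiv_add_smooth (u v : smoothNear I x) :
    mvfderiv I (u + v).1 x = mvfderiv I u.1 x + mvfderiv I v.1 x :=
  mvfderiv_add (u.2.self_of_nhds.mdifferentiableAt (by simp))
    (v.2.self_of_nhds.mdifferentiableAt (by simp))

theorem riemGrad_add (u v : smoothNear I x) :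
    riemGrad g x (u + v).1 = riemGrad g x u.1 + riemGrad g x v.1 := by
  refine eq_of_forall_inner_eq g fun w => ?_
  rw [map_add (g.inner x), add_apply, inner_riemGrad, inner_riemGrad, inner_riemGrad,
    mvfderiv_add_smooth, add_apply]

theorem vecInChart_add (v w : TangentSpace I x) :
    vecInChart e x (v + w) = vecInChart e x v + vecInChart e x w :=
  map_add (chartDeriv I e x) v w

theorem vecInChart_smul (a : ℝ) (v : TangentSpace I x) :
    vecInChart e x (a • v) = a • vecInChart e x v :=
  map_smul (chartDeriv I e x) a v

theorem vecInChart_sum {ι : Type*} (s : Finset ι) (v : ι → TangentSpace I x) :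
    vecInChart e x (∑ i ∈ s, v i) = ∑ i ∈ s, vecInChart e x (v i) :=
  map_sum (chartDeriv I e x) v s

theorem fderiv_fderiv_inChart_add (he : e ∈ atlas H X) (hx : x ∈ e.source) (u v : smoothNear I x) :
    fderiv ℝ (inChart I e (u + v).1) (e.extend I x) =
      fderiv ℝ (inChart I e u.1) (e.extend I x) + fderiv ℝ (inChart I e v.1) (e.extend I x) ∧
    fderiv ℝ (fderiv ℝ (inChart I e (u + v).1)) (e.extend I x) =
      fderiv ℝ (fderiv ℝ (inChart I e u.1)) (e.extend I x) +
        fderiv ℝ (fderiv ℝ (inChart I e v.1)) (e.extend I x) := by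
  have cu := contDiffAt_inChart I he hx u.2.self_of_nhds
  have cv := contDiffAt_inChart I he hx v.2.self_of_nhds
  have key := fderiv_add_eventually cu cv
  have heq : inChart I e (u + v).1 = inChart I e u.1 + inChart I e v.1 := rfl
  rw [heq]
  exact ⟨key.eq_of_nhds, by
    rw [key.fderiv_eq, fderiv_add (differentiableAt_fderiv cu) (differentiableAt_fderiv cv)]⟩

theorem riemHess_add (u v : smoothNear I x) (a b : TangentSpace I x) :
    riemHess g x (u + v).1 a b = riemHess g x u.1 a b + riemHess g x v.1 a b := by
  have hx := mem_chart_source H x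
  have he := chart_mem_atlas H x
  obtain ⟨T, hT⟩ := exists_christoffel_eq g he (mem_extend_target (I := I) hx)
  simp only [riemHess, hT, riemGrad_add, vecInChart_add,
    (fderiv_fderiv_inChart_add he hx u v).2, map_add, add_apply, LinearMap.add_apply]
  ring

theorem exists_riemHess_eq (x : X) (u : X → ℝ) :
    ∃ B : TangentSpace I x →ₗ[ℝ] TangentSpace I x →ₗ[ℝ] ℝ, ∀ v w, riemHess g x u v w = B v w := by
  obtain ⟨T, hT⟩ := exists_christoffel_eq g (chart_mem_atlas H x)
    (mem_extend_target (I := I) (mem_chart_source H x))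
  let D : E →ₗ[ℝ] E →ₗ[ℝ] ℝ := (fderiv ℝ (fderiv ℝ (inChart I (chartAt H x) u))
    ((chartAt H x).extend I x)).toLinearMap₁₂
  let c := chartAt H x
  let z := vecInChart c x (riemGrad g x u)
  have key : ∀ v w, riemHess g x u v w = D (vecInChart c x v) (vecInChart c x w) -
      (T (vecInChart c x v) (vecInChart c x w) z + T (vecInChart c x w) (vecInChart c x v) z -
        T z (vecInChart c x v) (vecInChart c x w)) / 2 := fun v w => by
    simp only [riemHess, hT]
    rfl
  refine ⟨LinearMap.mk₂ ℝ (riemHess g x u) (fun v w z => ?_) (fun c v w => ?_) (fun v w z => ?_)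
    (fun c v w => ?_), fun v w => rfl⟩
  · simp only [key, vecInChart_add, map_add, LinearMap.add_apply]
    ring
  · simp only [key, vecInChart_smul, map_smul, LinearMap.smul_apply, smul_eq_mul]
    ring
  · simp only [key, vecInChart_add, map_add, LinearMap.add_apply]
    ring
  · simp only [key, vecInChart_smul, map_smul, LinearMap.smul_apply, smul_eq_mul]
    ring

theorem riemHess_sum_sum {m : ℕ} (u : X → ℝ) (a c : Fin m → ℝ) (b : Fin m → TangentSpace I x) :
    riemHess g x u (∑ i, a i • b i) (∑ j, c j • b j) =
      ∑ i, ∑ j, a i * riemHess g x u (b i) (b j) * c j := by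
  obtain ⟨B, hB⟩ := exists_riemHess_eq g x u
  simp only [hB, map_sum, map_smul, LinearMap.sum_apply, LinearMap.smul_apply,
    smul_eq_mul, Finset.mul_sum]
  rw [Finset.sum_comm]
  exact Finset.sum_congr rfl fun i _ => Finset.sum_congr rfl fun j _ => by ring

theorem frameJet_jetOf {m : ℕ} (b : Fin m → TangentSpace I x) (u : smoothNear I x) :
    frameJet g x b (jetOf I x u) = frameJetFun g x b u := rfl

theorem exists_jetOf_eq (j : JetFibre I x) : ∃ u, jetOf I x u = j :=
  Submodule.Quotient.mk_surjective _ j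

theorem jetOf_add (u v : smoothNear I x) : jetOf I x (u + v) = jetOf I x u + jetOf I x v := rfl

theorem frameJet_add {m : ℕ} (b : Fin m → TangentSpace I x) (j k : JetFibre I x) :
    frameJet g x b (j + k) = frameJet g x b j + frameJet g x b k := by
  obtain ⟨u, rfl⟩ := exists_jetOf_eq j
  obtain ⟨v, rfl⟩ := exists_jetOf_eq k
  rw [← jetOf_add, frameJet_jetOf, frameJet_jetOf, frameJet_jetOf]
  refine Prod.ext rfl (Prod.ext ?_ (Subtype.ext ?_))
  · funext i
    simp only [frameJetFun, mvfderiv_add_smooth, Prod.snd_add, Prod.fst_add, Pi.add_apply,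
      add_apply]
  · ext i j
    exact riemHess_add g u v (b i) (b j)

/-- The change of the frame coordinates of a jet under a change of the frame. -/
theorem frameJet_change_frame {m : ℕ} (h : Matrix (Fin m) (Fin m) ℝ)
    (b b' : Fin m → TangentSpace I x) (hb : ∀ i, b' i = ∑ j, h i j • b j) (j : JetFibre I x) :
    frameJet g x b' j = jetAct h (frameJet g x b j) := by
  obtain ⟨u, rfl⟩ := exists_jetOf_eq j
  rw [frameJet_jetOf, frameJet_jetOf]
  refine Prod.ext rfl (Prod.ext ?_ (Subtype.ext ?_))
  · funext i
    simp only [frameJetFun, jetAct, hb, map_sum, map_smul, Matrix.mulVec, dotProduct, smul_eq_mul]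
  · ext i j
    simp only [frameJetFun, jetAct, Matrix.of_apply, Matrix.mul_apply, Matrix.transpose_apply]
    rw [hb, hb, riemHess_sum_sum, Finset.sum_comm]
    exact Finset.sum_congr rfl fun k _ => by rw [Finset.sum_mul]

theorem frameJet_mem_euclPos {m : ℕ} (b : Fin m → TangentSpace I x) {j : JetFibre I x}
    (hj : j ∈ jetPos g x) : frameJet g x b j ∈ euclPos m := by
  obtain ⟨u, rfl, h0, h1, h2⟩ := hj
  rw [frameJet_jetOf]
  refine ⟨h0, funext fun i => by simp [frameJetFun, h1], ?_⟩
  refine Matrix.PosSemidef.of_dotProduct_mulVec_nonneg ?_ fun a => ?_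
  · rw [Matrix.IsHermitian, Matrix.conjTranspose_eq_transpose_of_trivial]
    exact (frameJetFun g x b u).2.2.2
  · have h3 := h2 (∑ i, a i • b i)
    rw [riemHess_sum_sum] at h3
    simpa only [star_trivial, dotProduct, Matrix.mulVec, frameJetFun, Matrix.of_apply,
      Finset.mul_sum, mul_assoc] using h3

theorem frameJet_mem_euclNeg {m : ℕ} (b : Fin m → TangentSpace I x) {j : JetFibre I x}
    (hj : j ∈ jetNeg I x) : frameJet g x b j ∈ euclNeg m := by
  obtain ⟨s, hs, rfl⟩ := hj
  rw [frameJet_jetOf]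
  have hd : mvfderiv I (fun _ : X => s) x = 0 := mvfderiv_const s
  have hgrad : riemGrad g x (fun _ : X => s) = 0 := by
    refine eq_of_forall_inner_eq g fun w => ?_
    rw [inner_riemGrad, hd, map_zero (g.inner x)]
  have hc : inChart I (chartAt H x) (fun _ : X => s) = fun _ => s := rfl
  have hv0 : vecInChart (chartAt H x) x (0 : TangentSpace I x) = 0 :=
    map_zero (chartDeriv I (chartAt H x) x)
  refine ⟨hs, Prod.ext (funext fun i => by simp [frameJetFun, hd]) (Subtype.ext ?_)⟩
  ext i k
  have hG := christoffel_sum_smul g (chart_mem_atlas H x)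
    (mem_extend_target (I := I) (mem_chart_source H x)) (m := 0) (vecInChart (chartAt H x) x (b i))
    (vecInChart (chartAt H x) x (b k)) Fin.elim0 Fin.elim0
  simp only [Finset.univ_eq_empty, Finset.sum_empty] at hG
  change riemHess g x (fun _ => s) (b i) (b k) = 0
  simp only [riemHess, hgrad, hc, hv0, hG]
  simp

/-- Orthonormal families of full size. -/
structure IsOrthonormalBasisAt {m : ℕ} (x : X) (b : Fin m → TangentSpace I x) : Prop where
  inner_eq : ∀ i j, g.inner x (b i) (b j) = if i = j then 1 else 0
  span_eq : ⊤ ≤ Submodule.span ℝ (range b)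

variable {g}

theorem IsOrthonormalBasisAt.eq_sum {m : ℕ} {b : Fin m → TangentSpace I x}
    (hb : IsOrthonormalBasisAt g x b) (z : TangentSpace I x) :
    z = ∑ k, g.inner x z (b k) • b k := by
  obtain ⟨c, rfl⟩ := (Submodule.mem_span_range_iff_exists_fun ℝ).1 (hb.span_eq (Submodule.mem_top (x := z)))
  refine Finset.sum_congr rfl fun k _ => ?_
  congr 1
  simp [map_sum, hb.inner_eq]

theorem IsOrthonormalBasisAt.riemGrad_eq {m : ℕ} {b : Fin m → TangentSpace I x}
    (hb : IsOrthonormalBasisAt g x b) (u : X → ℝ) :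
    riemGrad g x u = ∑ k, mvfderiv I u x (b k) • b k := by
  conv_lhs => rw [hb.eq_sum (riemGrad g x u)]
  simp only [inner_riemGrad]

/-- The Hessian in terms of the coordinates of the jet and an orthonormal frame. -/
theorem IsOrthonormalBasisAt.riemHess_eq {m : ℕ} {b : Fin m → TangentSpace I x}
    (hb : IsOrthonormalBasisAt g x b) (he : e ∈ atlas H X) (hx : x ∈ e.source) {u : X → ℝ}
    (hu : ContMDiffAt I 𝓘(ℝ, ℝ) ∞ u x) (v w : TangentSpace I x) :
    riemHess g x u v w =
      fderiv ℝ (fderiv ℝ (inChart I e u)) (e.extend I x) (vecInChart e x v) (vecInChart e x w) -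
        ∑ k, fderiv ℝ (inChart I e u) (e.extend I x) (vecInChart e x (b k)) *
          christoffel g e (vecInChart e x v) (vecInChart e x w) (vecInChart e x (b k))
            (e.extend I x) := by
  rw [riemHess_eq_hessInChart g he hx hu, hessInChart, hb.riemGrad_eq, vecInChart_sum]
  simp only [vecInChart_smul]
  rw [christoffel_sum_smul g he (mem_extend_target hx)]
  simp only [mvfderiv_eq_fderiv_inChart he hx hu]

end HessianLinear

/-! ### Continuity of frame coordinates on the 2-jet bundle -/

section JetContinuity

variable {E : Type*} [NormedAddCommGroup E] [NormedSpace ℝ E] [FiniteDimensional ℝ E]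
  {H : Type*} [TopologicalSpace H] {I : ModelWithCorners ℝ E H} [I.Boundaryless]
  {X : Type*} [TopologicalSpace X] [ChartedSpace H X] [IsManifold I ∞ X]
  (g : ContMDiffRiemannianMetric I ∞ E (fun x : X => TangentSpace I x))
  {e : OpenPartialHomeomorph X H}

/-- The coordinates of the 2-jet of a function in a chart. -/
def taylorCoord (e : OpenPartialHomeomorph X H) (x : X) (u : smoothNear I x) :
    ℝ × (E →L[ℝ] ℝ) × (E →L[ℝ] E →L[ℝ] ℝ) :=
  (u.1 x, fderiv ℝ (inChart I e u.1) (e.extend I x),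
    fderiv ℝ (fderiv ℝ (inChart I e u.1)) (e.extend I x))

theorem taylorCoord_eq_of_jetOf_eq (he : e ∈ atlas H X) {x : X} (hx : x ∈ e.source)
    {u v : smoothNear I x} (h : jetOf I x u = jetOf I x v) :
    taylorCoord e x u = taylorCoord e x v := by
  have h1 := taylor_eq_of_jet_eq ((Submodule.Quotient.eq _).1 h)
  have h2 := h1.2 e he hx
  rw [taylorCoord, taylorCoord, h1.1, h2.1, h2.2]

/-- A function that represents a jet. -/
def jetRep {x : X} (j : JetFibre I x) : smoothNear I x := (exists_jetOf_eq j).choose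

theorem jetOf_jetRep {x : X} (j : JetFibre I x) : jetOf I x (jetRep j) = j :=
  (exists_jetOf_eq j).choose_spec

theorem isOpen_jetBox (he : e ∈ atlas H X)
    {O : Set (X × ℝ × (E →L[ℝ] ℝ) × (E →L[ℝ] E →L[ℝ] ℝ))} (hO : IsOpen O) :
    IsOpen (jetBox I e O) :=
  TopologicalSpace.isOpen_generateFrom_of_mem ⟨e, he, O, hO, rfl⟩

theorem mem_jetBox_iff (he : e ∈ atlas H X)
    {O : Set (X × ℝ × (E →L[ℝ] ℝ) × (E →L[ℝ] E →L[ℝ] ℝ))} {x : X} (u : smoothNear I x) :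
    (⟨x, jetOf I x u⟩ : JetBundle I X) ∈ jetBox I e O ↔
      x ∈ e.source ∧ (x, taylorCoord e x u) ∈ O := by
  constructor
  · rintro ⟨hx, v, hv, hO⟩
    exact ⟨hx, taylorCoord_eq_of_jetOf_eq he hx hv ▸ hO⟩
  · rintro ⟨hx, hO⟩
    exact ⟨hx, u, rfl, hO⟩

/-- The coordinates of a jet in a chart. -/
def jetCoord (e : OpenPartialHomeomorph X H) (J : JetBundle I X) :
    X × ℝ × (E →L[ℝ] ℝ) × (E →L[ℝ] E →L[ℝ] ℝ) :=
  (J.base, taylorCoord e J.base (jetRep J.jet))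

theorem jetBox_eq (he : e ∈ atlas H X)
    (O : Set (X × ℝ × (E →L[ℝ] ℝ) × (E →L[ℝ] E →L[ℝ] ℝ))) :
    jetBox I e O = {J | J.base ∈ e.source ∧ jetCoord e J ∈ O} := by
  ext ⟨x, j⟩
  have h := mem_jetBox_iff he (O := O) (jetRep j)
  rw [jetOf_jetRep] at h
  exact h

theorem continuousAt_jetCoord (he : e ∈ atlas H X) {J : JetBundle I X} (hJ : J.base ∈ e.source) :
    ContinuousAt (jetCoord (I := I) e) J := by
  refine tendsto_nhds.2 fun O hO hJO => ?_
  have h := (isOpen_jetBox he hO).mem_nhds (show J ∈ jetBox I e O by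
    rw [jetBox_eq he]; exact ⟨hJ, hJO⟩)
  filter_upwards [h] with K hK
  rw [jetBox_eq he] at hK
  exact hK.2

theorem continuous_jetBundle_base : Continuous (JetBundle.base : JetBundle I X → X) := by
  rw [continuous_iff_continuousAt]
  intro J
  exact (continuousAt_jetCoord (chart_mem_atlas H J.base) (mem_chart_source H J.base)).fst

theorem continuousAt_vecInChart (he : e ∈ atlas H X) {x : X} (hx : x ∈ e.source)
    {ξ : ∀ y : X, TangentSpace I y}
    (hξ : ContMDiffAt I I.tangent ∞ (fun y => (TotalSpace.mk' E y (ξ y) : TangentBundle I X)) x) :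
    ContinuousAt (fun y => vecInChart e y (ξ y)) x := by
  have h1 := ((IsManifold.subset_maximalAtlas (I := I) (n := ∞) he) |> e.contMDiffOn_extend
    ).contMDiffOn_tangentMapWithin (m := ∞) le_rfl e.open_source.uniqueMDiffOn
  have h2 := (h1.contMDiffAt (x := (TotalSpace.mk' E x (ξ x) : TangentBundle I X))
    ((e.open_source.preimage (FiberBundle.continuous_proj E _)).mem_nhds hx)).comp x hξ
  have h3 := (contMDiffAt_totalSpace.1 h2).2.continuousAt
  refine h3.congr ?_
  filter_upwards [e.open_source.mem_nhds hx] with z hz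
  simp only [Function.comp, tangentMapWithin, vecInChart]
  rw [mfderivWithin_of_isOpen e.open_source hz]
  simp
  rfl

set_option maxSynthPendingDepth 3 in
theorem continuousAt_christoffel (he : e ∈ atlas H X) {x : X} (hx : x ∈ e.source)
    {v w z : X → E} (hv : ContinuousAt v x) (hw : ContinuousAt w x) (hz : ContinuousAt z x) :
    ContinuousAt (fun y => christoffel g e (v y) (w y) (z y) (e.extend I y)) x := by
  have hD : ContinuousAt (fderiv ℝ (metricForm g e)) (e.extend I x) :=
    ((contDiffAt_metricForm g he (mem_extend_target hx)).fderiv_right (m := 0)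
      (by simp)).continuousAt
  have hD' : ContinuousAt (fun y => fderiv ℝ (metricForm g e) (e.extend I y)) x :=
    hD.comp (f := e.extend I) (contMDiffAt_extend_of_mem_atlas he hx).continuousAt
  have h : ∀ {a b c : X → E}, ContinuousAt a x → ContinuousAt b x → ContinuousAt c x →
      ContinuousAt (fun y => fderiv ℝ (metricForm g e) (e.extend I y) (a y) (b y) (c y)) x :=
    fun ha hb hc => ((hD'.clm_apply ha).clm_apply hb).clm_apply hc
  refine (((h hv hw hz).add (h hw hv hz)).sub (h hz hv hw)).div_const 2 |>.congr ?_
  filter_upwards [e.open_source.mem_nhds hx] with y hy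
  exact (christoffel_eq g he (mem_extend_target hy) _ _ _).symm

/-- Frame coordinates with respect to an orthonormal frame are continuous on the total space. -/
theorem continuousAt_frameJet {m : ℕ} (ξ : TangentFrame I X m)
    (hξ : ∀ x ∈ ξ.domain, IsOrthonormalBasisAt g x fun i => ξ.vec i x)
    {J : JetBundle I X} (hJ : J.base ∈ ξ.domain) :
    ContinuousAt (fun K : JetBundle I X => frameJet g K.base (fun i => ξ.vec i K.base) K.jet) J := by
  set c := chartAt H J.base with hc
  have he : c ∈ atlas H X := chart_mem_atlas H _
  have hx : J.base ∈ c.source := mem_chart_source H _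
  have hK := continuousAt_jetCoord he hx
  have hbase : ContinuousAt (JetBundle.base : JetBundle I X → X) J :=
    continuous_jetBundle_base.continuousAt
  have hvec : ∀ i, ContinuousAt (fun K : JetBundle I X => vecInChart c K.base (ξ.vec i K.base)) J :=
    fun i => (continuousAt_vecInChart he hx
      (ξ.isFrame.contMDiffAt ξ.isOpen_domain hJ i)).comp (f := JetBundle.base) hbase
  have hvecX : ∀ i, ContinuousAt (fun y => vecInChart c y (ξ.vec i y)) J.base := fun i =>
    continuousAt_vecInChart he hx (ξ.isFrame.contMDiffAt ξ.isOpen_domain hJ i)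
  have hev : ∀ᶠ K : JetBundle I X in 𝓝 J, K.base ∈ c.source ∧ K.base ∈ ξ.domain :=
    (hbase.eventually (c.open_source.eventually_mem hx)).and
      (hbase.eventually (ξ.isOpen_domain.eventually_mem hJ))
  have hfr : ∀ K : JetBundle I X, frameJet g K.base (fun i => ξ.vec i K.base) K.jet =
      frameJetFun g K.base (fun i => ξ.vec i K.base) (jetRep K.jet) := fun K => by
    conv_lhs => rw [← jetOf_jetRep K.jet]
    rfl
  simp only [hfr]
  have h1 : ContinuousAt (fun K : JetBundle I X => (jetCoord c K).2.1) J := hK.snd.fst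
  have h2 : ContinuousAt (fun K : JetBundle I X => (jetCoord c K).2.2.1) J := hK.snd.snd.fst
  have h3 : ContinuousAt (fun K : JetBundle I X => (jetCoord c K).2.2.2) J := hK.snd.snd.snd
  refine h1.prodMk (ContinuousAt.prodMk (continuousAt_pi.2 fun i => ?_) ?_)
  · refine (h2.clm_apply (hvec i)).congr (hev.mono fun K hKm => ?_)
    exact (mvfderiv_eq_fderiv_inChart he hKm.1 (jetRep K.jet).2.self_of_nhds _).symm
  · refine tendsto_subtype_rng.2 (tendsto_pi_nhds.2 fun i => tendsto_pi_nhds.2 fun j => ?_)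
    have h4 : ContinuousAt (fun K : JetBundle I X =>
        (jetCoord c K).2.2.2 (vecInChart c K.base (ξ.vec i K.base))
          (vecInChart c K.base (ξ.vec j K.base)) -
        ∑ k, (jetCoord c K).2.2.1 (vecInChart c K.base (ξ.vec k K.base)) *
          christoffel g c (vecInChart c K.base (ξ.vec i K.base))
            (vecInChart c K.base (ξ.vec j K.base)) (vecInChart c K.base (ξ.vec k K.base))
            (c.extend I K.base)) J := by
      refine ((h3.clm_apply (hvec i)).clm_apply (hvec j)).sub ?_
      refine tendsto_finsetSum _ fun k _ => (h2.clm_apply (hvec k)).mul ?_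
      exact (continuousAt_christoffel g he hx (hvecX i) (hvecX j) (hvecX k)).comp
        (f := JetBundle.base) hbase
    refine h4.congr (hev.mono fun K hKm => ?_)
    exact ((hξ _ hKm.2).riemHess_eq he hKm.1 (jetRep K.jet).2.self_of_nhds _ _).symm

end JetContinuity

/-! ### Jets with prescribed frame coordinates -/

section JetSection

variable {E : Type*} [NormedAddCommGroup E] [NormedSpace ℝ E] [FiniteDimensional ℝ E]
  {H : Type*} [TopologicalSpace H] {I : ModelWithCorners ℝ E H} [I.Boundaryless]
  {X : Type*} [TopologicalSpace X] [ChartedSpace H X] [IsManifold I ∞ X]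
  (g : ContMDiffRiemannianMetric I ∞ E (fun x : X => TangentSpace I x))
  {e : OpenPartialHomeomorph X H} {x : X}

theorem christoffel_symm (v w z y : E) : christoffel g e v w z y = christoffel g e w v z y := by
  have hm : metricCoeff g e v w = metricCoeff g e w v := funext fun y => g.symm _ _ _
  simp only [christoffel, hm]
  ring

/-- The quadratic polynomial with value `r`, derivative `l` and Hessian `B` (if `B` is symmetric)
at `y₀`. -/
def taylorPoly (y₀ : E) (T : ℝ × (E →L[ℝ] ℝ) × (E →L[ℝ] E →L[ℝ] ℝ)) (y : E) : ℝ :=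
  T.1 + T.2.1 (y - y₀) + 2⁻¹ * T.2.2 (y - y₀) (y - y₀)

theorem contDiff_taylorPoly (y₀ : E) (T : ℝ × (E →L[ℝ] ℝ) × (E →L[ℝ] E →L[ℝ] ℝ)) :
    ContDiff ℝ ∞ (taylorPoly y₀ T) := by
  unfold taylorPoly
  fun_prop

theorem fderiv_taylorPoly (y₀ : E) (T : ℝ × (E →L[ℝ] ℝ) × (E →L[ℝ] E →L[ℝ] ℝ)) (y : E) :
    fderiv ℝ (taylorPoly y₀ T) y =
      T.2.1 + (2⁻¹ : ℝ) • (T.2.2 + T.2.2.flip) (y - y₀) := by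
  have h0 : HasFDerivAt (fun y : E => y - y₀) (ContinuousLinearMap.id ℝ E) y :=
    (hasFDerivAt_id y).sub_const y₀
  have h1 : HasFDerivAt (fun y : E => T.2.1 (y - y₀))
      (T.2.1.comp (ContinuousLinearMap.id ℝ E)) y := T.2.1.hasFDerivAt.comp (x := y) h0
  have h2 : HasFDerivAt (fun y : E => T.2.2 (y - y₀))
      (T.2.2.comp (ContinuousLinearMap.id ℝ E)) y :=
    HasFDerivAt.comp (G := E →L[ℝ] ℝ) y T.2.2.hasFDerivAt h0
  have h := ((h1.const_add T.1).add ((h2.clm_apply h0).const_mul (2⁻¹ : ℝ))).fderiv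
  refine Eq.trans h ?_
  ext v
  simp

theorem fderiv_fderiv_taylorPoly (y₀ : E) (T : ℝ × (E →L[ℝ] ℝ) × (E →L[ℝ] E →L[ℝ] ℝ)) (y v w : E) :
    fderiv ℝ (fderiv ℝ (taylorPoly y₀ T)) y v w = 2⁻¹ * (T.2.2 v w + T.2.2 w v) := by
  have h0 : HasFDerivAt (fun y : E => y - y₀) (ContinuousLinearMap.id ℝ E) y :=
    (hasFDerivAt_id y).sub_const y₀
  have h2 : HasFDerivAt (fun y : E => (T.2.2 + T.2.2.flip) (y - y₀))
      ((T.2.2 + T.2.2.flip).comp (ContinuousLinearMap.id ℝ E)) y :=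
    HasFDerivAt.comp (G := E →L[ℝ] ℝ) y (T.2.2 + T.2.2.flip).hasFDerivAt h0
  have h := ((h2.const_smul (2⁻¹ : ℝ)).const_add T.2.1).fderiv
  rw [funext (fderiv_taylorPoly y₀ T)]
  refine (congrArg (fun D : E →L[ℝ] E →L[ℝ] ℝ => D v w) h).trans ?_
  simp [mul_add]

variable (I) in
/-- The function near `x` that is a given quadratic polynomial in the preferred chart at `x`. -/
def taylorFun (x : X) :
    ℝ × (E →L[ℝ] ℝ) × (E →L[ℝ] E →L[ℝ] ℝ) →ₗ[ℝ] smoothNear I x where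
  toFun T := ⟨fun y => taylorPoly ((chartAt H x).extend I x) T ((chartAt H x).extend I y), by
    filter_upwards [(chartAt H x).open_source.mem_nhds (mem_chart_source H x)] with y hy
    exact (contDiff_taylorPoly _ T).contMDiff.contMDiffAt.comp y
      (contMDiffAt_extend_of_mem_atlas (chart_mem_atlas H x) hy)⟩
  map_add' T S := by
    refine Subtype.ext (funext fun y => ?_)
    change taylorPoly _ _ _ = taylorPoly _ _ _ + taylorPoly _ _ _
    simp only [taylorPoly, Prod.fst_add, Prod.snd_add, add_apply]
    ring
  map_smul' c T := by
    refine Subtype.ext (funext fun y => ?_)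
    change taylorPoly _ _ _ = c • taylorPoly _ _ _
    simp only [taylorPoly, Prod.smul_fst, Prod.smul_snd, smul_apply, smul_eq_mul]
    ring

theorem inChart_taylorFun (T : ℝ × (E →L[ℝ] ℝ) × (E →L[ℝ] E →L[ℝ] ℝ)) :
    inChart I (chartAt H x) (taylorFun I x T).1 =ᶠ[𝓝 ((chartAt H x).extend I x)]
      taylorPoly ((chartAt H x).extend I x) T := by
  filter_upwards [(chartAt H x).isOpen_extend_target.mem_nhds
    (mem_extend_target (I := I) (mem_chart_source H x))] with y hy
  change taylorPoly _ T (((chartAt H x).extend I) (((chartAt H x).extend I).symm y)) = _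
  rw [((chartAt H x).extend I).right_inv hy]

theorem fderiv_inChart_taylorFun (T : ℝ × (E →L[ℝ] ℝ) × (E →L[ℝ] E →L[ℝ] ℝ)) :
    fderiv ℝ (inChart I (chartAt H x) (taylorFun I x T).1) ((chartAt H x).extend I x) = T.2.1 := by
  rw [(inChart_taylorFun T).fderiv_eq, fderiv_taylorPoly]
  simp

theorem fderiv_fderiv_inChart_taylorFun (T : ℝ × (E →L[ℝ] ℝ) × (E →L[ℝ] E →L[ℝ] ℝ)) (v w : E) :
    fderiv ℝ (fderiv ℝ (inChart I (chartAt H x) (taylorFun I x T).1)) ((chartAt H x).extend I x)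
      v w = 2⁻¹ * (T.2.2 v w + T.2.2 w v) := by
  rw [(inChart_taylorFun T).fderiv.fderiv_eq, fderiv_fderiv_taylorPoly]

set_option maxSynthPendingDepth 3 in
/-- For functionals `θ i` and coefficients `Γ`, the linear map
`(r, p, A) ↦ (r, ∑ pᵢ θᵢ, ∑ (Aᵢⱼ + ∑ pₖ Γᵢⱼₖ) θᵢ ⊗ θⱼ)`. -/
def dualTaylor {m : ℕ} (θ : Fin m → E →L[ℝ] ℝ) (Γ : Fin m → Fin m → Fin m → ℝ) :
    EuclJet m →ₗ[ℝ] ℝ × (E →L[ℝ] ℝ) × (E →L[ℝ] E →L[ℝ] ℝ) where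
  toFun J := (J.1, ∑ i, J.2.1 i • θ i,
    ∑ i, ∑ j, (J.2.2.1 i j + ∑ k, J.2.1 k * Γ i j k) • (θ i).smulRight (θ j))
  map_add' J K := by
    refine Prod.ext rfl (Prod.ext ?_ ?_)
    · simp only [Prod.snd_add, Prod.fst_add, Pi.add_apply, add_smul, Finset.sum_add_distrib]
    · refine ContinuousLinearMap.ext fun v => ContinuousLinearMap.ext fun w => ?_
      simp only [Prod.snd_add, Prod.fst_add, Pi.add_apply, add_apply, sum_apply, smul_apply,
        smul_eq_mul, Submodule.coe_add, Matrix.add_apply, add_mul, Finset.sum_add_distrib]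
      ring
  map_smul' a J := by
    refine Prod.ext rfl (Prod.ext ?_ ?_)
    · simp only [Prod.smul_snd, Prod.smul_fst, Pi.smul_apply, smul_assoc, Finset.smul_sum,
        RingHom.id_apply]
    · refine ContinuousLinearMap.ext fun v => ContinuousLinearMap.ext fun w => ?_
      simp only [Prod.smul_snd, Prod.smul_fst, Pi.smul_apply, smul_apply, sum_apply,
        smul_eq_mul, Submodule.coe_smul, Matrix.smul_apply, RingHom.id_apply, mul_assoc,
        ← Finset.mul_sum, ← mul_add]

theorem dualTaylor_fst {m : ℕ} {θ : Fin m → E →L[ℝ] ℝ} {v : Fin m → E}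
    (h : ∀ i j, θ i (v j) = if i = j then 1 else 0) (Γ : Fin m → Fin m → Fin m → ℝ)
    (J : EuclJet m) (i : Fin m) : (dualTaylor θ Γ J).2.1 (v i) = J.2.1 i := by
  simp [dualTaylor, h]

set_option maxSynthPendingDepth 3 in
theorem dualTaylor_snd {m : ℕ} {θ : Fin m → E →L[ℝ] ℝ} {v : Fin m → E}
    (h : ∀ i j, θ i (v j) = if i = j then 1 else 0) (Γ : Fin m → Fin m → Fin m → ℝ)
    (J : EuclJet m) (i j : Fin m) :
    (dualTaylor θ Γ J).2.2 (v i) (v j) = J.2.2.1 i j + ∑ k, J.2.1 k * Γ i j k := by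
  simp [dualTaylor, h]

/-- The Taylor coefficients, in the preferred chart at `x`, of a function with prescribed
coordinates of its 2-jet in the frame `b`. -/
def frameTaylor {m : ℕ} (x : X) (b : Fin m → TangentSpace I x) :
    EuclJet m →ₗ[ℝ] ℝ × (E →L[ℝ] ℝ) × (E →L[ℝ] E →L[ℝ] ℝ) :=
  let c := chartAt H x
  dualTaylor (fun i => metricForm g c (c.extend I x) (vecInChart c x (b i))) fun i j k =>
    christoffel g c (vecInChart c x (b i)) (vecInChart c x (b j)) (vecInChart c x (b k))
      (c.extend I x)

variable {g}

theorem frameJetFun_taylorFun {m : ℕ} {b : Fin m → TangentSpace I x}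
    (hb : IsOrthonormalBasisAt g x b) (J : EuclJet m) :
    frameJetFun g x b (taylorFun I x (frameTaylor g x b J)) = J := by
  have he := chart_mem_atlas H x
  have hx := mem_chart_source H x
  have hu := (taylorFun I x (frameTaylor g x b J)).2.self_of_nhds
  have hθ : ∀ i j, metricForm g (chartAt H x) ((chartAt H x).extend I x)
      (vecInChart (chartAt H x) x (b i)) (vecInChart (chartAt H x) x (b j)) =
      if i = j then 1 else 0 := fun i j => by
    rw [← inner_eq_metricForm g he hx, hb.inner_eq]
  have hl := fun Γ J => dualTaylor_fst hθ Γ J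
  have hB := fun Γ J => dualTaylor_snd hθ Γ J
  have hA : ∀ i j, J.2.2.1 j i = J.2.2.1 i j := fun i j => J.2.2.2.apply i j
  refine Prod.ext ?_ (Prod.ext (funext fun i => ?_) (Subtype.ext (Matrix.ext fun i j => ?_)))
  · change taylorPoly _ _ _ = _
    simp [taylorPoly, frameTaylor, dualTaylor]
  · change mvfderiv I _ x (b i) = _
    rw [mvfderiv_eq_fderiv_inChart he hx hu, fderiv_inChart_taylorFun, frameTaylor, hl]
  · change riemHess g x _ (b i) (b j) = _
    rw [hb.riemHess_eq he hx hu, fderiv_fderiv_inChart_taylorFun, fderiv_inChart_taylorFun,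
      frameTaylor, hB, hB]
    simp only [hl, hA i j, christoffel_symm g (vecInChart (chartAt H x) x (b j))
      (vecInChart (chartAt H x) x (b i))]
    ring

/-- The Taylor coefficients of functions in a chart, as a linear map. -/
def taylorCoordLin (he : e ∈ atlas H X) (hx : x ∈ e.source) :
    smoothNear I x →ₗ[ℝ] ℝ × (E →L[ℝ] ℝ) × (E →L[ℝ] E →L[ℝ] ℝ) where
  toFun := taylorCoord e x
  map_add' u v := by
    have h := fderiv_fderiv_inChart_add he hx u v
    rw [taylorCoord, h.1, h.2]
    rfl
  map_smul' c u := by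
    have key : fderiv ℝ (c • inChart I e u.1) = c • fderiv ℝ (inChart I e u.1) :=
      fderiv_const_smul_field c
    have cu := contDiffAt_inChart I he hx u.2.self_of_nhds
    have heq : inChart I e (c • u).1 = c • inChart I e u.1 := rfl
    rw [taylorCoord, heq, key, ((differentiableAt_fderiv cu).hasFDerivAt.const_smul c).fderiv]
    rfl

set_option maxSynthPendingDepth 3 in
theorem continuous_add_jetOf {V : Type*} [AddCommGroup V] [Module ℝ V]
    [TopologicalSpace V] [IsTopologicalAddGroup V] [ContinuousSMul ℝ V] [T2Space V]
    [FiniteDimensional ℝ V] (L : V →ₗ[ℝ] smoothNear I x) (j : JetFibre I x) :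
    Continuous fun v => j + jetOf I x (L v) := by
  obtain ⟨u, rfl⟩ := exists_jetOf_eq j
  refine continuous_induced_rng.2 (continuous_generateFrom_iff.2 ?_)
  rintro _ ⟨e, he, O, hO, rfl⟩
  by_cases hx : x ∈ e.source
  · have h : Continuous fun v => (x, taylorCoordLin he hx u + (taylorCoordLin he hx ∘ₗ L) v) :=
      continuous_const.prodMk (continuous_const.add
        (LinearMap.continuous_of_finiteDimensional _))
    convert hO.preimage h using 1
    ext v
    rw [mem_preimage, mem_preimage, Function.comp_apply, ← jetOf_add, mem_jetBox_iff he,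
      and_iff_right hx, LinearMap.comp_apply, ← map_add]
    rfl
  · convert isOpen_empty using 1
    exact eq_empty_of_forall_notMem fun v hv => hx hv.1

/-- A continuous affine section, through a given jet, of the frame coordinates on the fibre. -/
theorem IsOrthonormalBasisAt.exists_section {m : ℕ} {b : Fin m → TangentSpace I x}
    (hb : IsOrthonormalBasisAt g x b) (j : JetFibre I x) :
    ∃ s : EuclJet m → JetFibre I x, Continuous s ∧ (∀ K, frameJet g x b (s K) = K) ∧
      s (frameJet g x b j) = j := by
  let L := taylorFun I x ∘ₗ frameTaylor g x b
  have hc := continuous_add_jetOf L j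
  refine ⟨fun K => j + jetOf I x (L (K - frameJet g x b j)), ?_, fun K => ?_, ?_⟩
  · exact hc.comp (continuous_id.sub continuous_const)
  · rw [frameJet_add, frameJet_jetOf]
    exact (congrArg _ (frameJetFun_taylorFun hb _)).trans (add_sub_cancel _ _)
  · change j + jetOf I x (L (frameJet g x b j - frameJet g x b j)) = j
    rw [sub_self, map_zero]
    exact add_zero j

end JetSection

/-! ### Orthonormal frames -/

section OrthonormalFrames

variable {E : Type*} [NormedAddCommGroup E] [NormedSpace ℝ E] [FiniteDimensional ℝ E]
  {H : Type*} [TopologicalSpace H] {I : ModelWithCorners ℝ E H}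
  {X : Type*} [TopologicalSpace X] [ChartedSpace H X] [IsManifold I ∞ X]
  (g : ContMDiffRiemannianMetric I ∞ E (fun x : X => TangentSpace I x))

/-- The vector field `s` is smooth on `U`. -/
def IsSmoothFieldOn (s : ∀ x : X, TangentSpace I x) (U : Set X) : Prop :=
  ContMDiffOn I I.tangent ∞ (fun y => (TotalSpace.mk' E y (s y) : TangentBundle I X)) U

theorem contMDiffOn_inner {s t : ∀ x : X, TangentSpace I x} {U : Set X} (hs : IsSmoothFieldOn s U)
    (ht : IsSmoothFieldOn t U) : ContMDiffOn I 𝓘(ℝ, ℝ) ∞ (fun y => g.inner y (s y) (t y)) U := by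
  intro x hx
  have h2 := ContMDiffWithinAt.clm_bundle_apply₂ (F₁ := E) (F₂ := E) (F₃ := ℝ)
    (E₃ := Bundle.Trivial X ℝ) (g.contMDiff.contMDiffAt.contMDiffWithinAt (s := U)) (hs x hx)
    (ht x hx)
  exact (contMDiffWithinAt_totalSpace.1 h2).2

theorem exists_isSmoothFieldOn_eq (x : X) (z : TangentSpace I x) :
    ∃ (s : ∀ x : X, TangentSpace I x) (U : Set X), IsOpen U ∧ x ∈ U ∧ IsSmoothFieldOn s U ∧
      s x = z := by
  let e := trivializationAt E (TangentSpace I) x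
  have hx : x ∈ e.baseSet := mem_baseSet_trivializationAt E _ x
  refine ⟨fun y => e.symm y (e ⟨x, z⟩).2, e.baseSet, e.open_baseSet, hx, ?_, ?_⟩
  · have := e.contMDiffOn_symm (IB := I) (n := ∞)
    refine (this.comp (s := e.baseSet) (f := fun y => (y, (e ⟨x, z⟩).2)) ?_ ?_).congr ?_
    · exact (contMDiff_id.prodMk contMDiff_const).contMDiffOn
    · intro y hy; exact e.mem_target.2 hy
    · intro y hy; simp [e.mk_symm hy]
  · exact e.symm_apply_apply_mk hx z

/-- The fields `s i` are smooth and orthonormal on `U`. -/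
structure IsOrthonormalOn {k : ℕ} (s : Fin k → ∀ x : X, TangentSpace I x) (U : Set X) : Prop where
  smooth : ∀ i, IsSmoothFieldOn (s i) U
  inner_eq : ∀ x ∈ U, ∀ i j, g.inner x (s i x) (s j x) = if i = j then 1 else 0

variable {g}

/-- One step of the Gram-Schmidt process. -/
theorem IsOrthonormalOn.exists_unit_normal {k : ℕ} {s : Fin k → ∀ x : X, TangentSpace I x}
    {U : Set X} (hU : IsOpen U) (hs : IsOrthonormalOn g s U) {x : X} (hx : x ∈ U)
    (hk : k < Module.finrank ℝ E) :
    ∃ (f : ∀ x : X, TangentSpace I x) (V : Set X), IsOpen V ∧ x ∈ V ∧ V ⊆ U ∧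
      IsSmoothFieldOn f V ∧
      ∀ y ∈ V, g.inner y (f y) (f y) = 1 ∧ ∀ i, g.inner y (f y) (s i y) = 0 := by
  obtain ⟨z, hz⟩ : ∃ z : TangentSpace I x, z ∉ Submodule.span ℝ (range fun i => s i x) := by
    by_contra! h
    have h1 : Module.finrank ℝ E ≤ k := by
      have h2 := finrank_range_le_card (R := ℝ) (M := TangentSpace I x) fun i => s i x
      rw [Set.finrank, Submodule.eq_top_iff'.2 h, finrank_top, Fintype.card_fin] at h2
      exact h2
    omega
  obtain ⟨f₀, W, hW, hxW, hf₀, rfl⟩ := exists_isSmoothFieldOn_eq x z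
  have hUW : IsOpen (U ∩ W) := hU.inter hW
  have hsm : ∀ i, IsSmoothFieldOn (s i) (U ∩ W) := fun i => (hs.smooth i).mono inter_subset_left
  have hf₁ : IsSmoothFieldOn f₀ (U ∩ W) := hf₀.mono inter_subset_right
  let t : ∀ x : X, TangentSpace I x := fun y =>
    f₀ y - ∑ i, g.inner y (f₀ y) (s i y) • s i y
  have ht : IsSmoothFieldOn t (U ∩ W) :=
    ContMDiffOn.sub_section hf₁ (ContMDiffOn.sum_section fun i _ =>
      ContMDiffOn.smul_section (contMDiffOn_inner g hf₁ (hsm i)) (hsm i))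
  have htt := contMDiffOn_inner g ht ht
  have hts : ∀ y ∈ U, ∀ j, g.inner y (t y) (s j y) = 0 := by
    intro y hy j
    simp only [t]
    rw [map_sub (g.inner y), map_sum (g.inner y)]
    simp [sub_apply, sum_apply, hs.inner_eq y hy]
  let V := (U ∩ W) ∩ (fun y => g.inner y (t y) (t y)) ⁻¹' Ioi 0
  have hV : IsOpen V := htt.continuousOn.isOpen_inter_preimage hUW isOpen_Ioi
  refine ⟨fun y => (Real.sqrt (g.inner y (t y) (t y)))⁻¹ • t y, V, hV, ⟨⟨hx, hxW⟩, ?_⟩,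
    fun y hy => hy.1.1, ?_, fun y hy => ⟨?_, fun i => ?_⟩⟩
  · refine g.pos x (t x) fun h0 => hz ?_
    rw [sub_eq_zero.1 h0]
    exact Submodule.sum_mem _ fun i _ => Submodule.smul_mem _ _ (Submodule.subset_span ⟨i, rfl⟩)
  · refine ContMDiffOn.smul_section ?_ (ht.mono inter_subset_left)
    intro y hy
    have h1 : ContDiffAt ℝ ∞ (fun r : ℝ => (Real.sqrt r)⁻¹) (g.inner y (t y) (t y)) :=
      (Real.contDiffAt_sqrt (ne_of_gt hy.2)).inv (Real.sqrt_ne_zero'.2 hy.2)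
    exact ContMDiffAt.comp_contMDiffWithinAt (g := fun r : ℝ => (Real.sqrt r)⁻¹) y h1.contMDiffAt
      ((htt y hy.1).mono (inter_subset_left : V ⊆ U ∩ W))
  · have h0 : 0 < g.inner y (t y) (t y) := hy.2
    rw [map_smul (g.inner y), smul_apply, map_smul, smul_eq_mul, smul_eq_mul, ← mul_assoc,
      ← mul_inv, Real.mul_self_sqrt h0.le, inv_mul_cancel₀ h0.ne']
  · rw [map_smul (g.inner y), smul_apply, hts y hy.1.1, smul_zero]

/-- A unit vector field can be completed to a local orthonormal frame. -/
theorem exists_isOrthonormalOn {ξ : ∀ x : X, TangentSpace I x} (hξ : IsSmoothFieldOn ξ univ)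
    (hξ1 : ∀ x, g.inner x (ξ x) (ξ x) = 1) (x : X) (k : ℕ) (hk : k + 1 ≤ Module.finrank ℝ E) :
    ∃ (s : Fin (k + 1) → ∀ x : X, TangentSpace I x) (U : Set X), IsOpen U ∧ x ∈ U ∧
      IsOrthonormalOn g s U ∧ s 0 = ξ := by
  induction k with
  | zero => exact ⟨fun _ => ξ, univ, isOpen_univ, mem_univ x, ⟨fun _ => hξ, fun y _ i j => by
      rw [if_pos (Fin.ext (by omega)), hξ1]⟩, rfl⟩
  | succ k ih =>
    obtain ⟨s, U, hU, hxU, hs, h0⟩ := ih (by omega)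
    obtain ⟨f, V, hV, hxV, hVU, hf, hn⟩ := hs.exists_unit_normal hU hxU (by omega)
    refine ⟨Fin.snoc (α := fun _ => ∀ x : X, TangentSpace I x) s f, V, hV, hxV,
      ⟨fun i => ?_, fun y hy i j => ?_⟩, ?_⟩
    · refine Fin.lastCases ?_ (fun i => ?_) i
      · rw [Fin.snoc_last]
        exact hf
      · rw [Fin.snoc_castSucc]
        exact (hs.smooth i).mono hVU
    · refine Fin.lastCases ?_ (fun i => ?_) i <;> refine Fin.lastCases ?_ (fun j => ?_) j
      · simp only [Fin.snoc_last, (hn y hy).1, if_pos]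
      · simp only [Fin.snoc_last, Fin.snoc_castSucc, (hn y hy).2 j]
        rw [if_neg (Fin.castSucc_lt_last j).ne']
      · simp only [Fin.snoc_last, Fin.snoc_castSucc]
        rw [g.symm, (hn y hy).2 i, if_neg (Fin.castSucc_lt_last i).ne]
      · simp only [Fin.snoc_castSucc, hs.inner_eq y (hVU hy), Fin.castSucc_inj]
    · rw [← Fin.castSucc_zero, Fin.snoc_castSucc, h0]

theorem linearIndependent_of_inner_eq {m : ℕ} {x : X} {b : Fin m → TangentSpace I x}
    (hb : ∀ i j, g.inner x (b i) (b j) = if i = j then 1 else 0) : LinearIndependent ℝ b := by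
  rw [Fintype.linearIndependent_iff]
  intro a ha i
  have h : g.inner x (∑ k, a k • b k) (b i) = a i := by
    rw [map_sum (g.inner x)]
    simp [hb]
  rw [← h, ha, map_zero (g.inner x), zero_apply]

theorem span_eq_top_of_inner_eq {m : ℕ} {x : X} {b : Fin m → TangentSpace I x}
    (hb : ∀ i j, g.inner x (b i) (b j) = if i = j then 1 else 0)
    (hm : m = Module.finrank ℝ E) : ⊤ ≤ Submodule.span ℝ (range b) := by
  have h : FiniteDimensional ℝ (TangentSpace I x) := inferInstanceAs (FiniteDimensional ℝ E)
  exact (((linearIndependent_of_inner_eq hb).span_eq_top_of_card_eq_finrank'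
    ((Fintype.card_fin m).trans hm))).ge

end OrthonormalFrames

/-! ### Adapted frames of the product `ℝ × M` -/

section AdaptedFrames

variable {E : Type*} [NormedAddCommGroup E] [NormedSpace ℝ E] [FiniteDimensional ℝ E]
  {H : Type*} [TopologicalSpace H] {I : ModelWithCorners ℝ E H} [I.Boundaryless]
  {M : Type*} [TopologicalSpace M] [ChartedSpace H M] [IsManifold I ∞ M]
  (g : ContMDiffRiemannianMetric I ∞ E (fun x : M => TangentSpace I x))

/-- The field `∂/∂t` on `ℝ × M`. -/
def timeField (I : ModelWithCorners ℝ E H) (p : ℝ × M) : TangentSpace (𝓘(ℝ, ℝ).prod I) p :=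
  ((1, 0) : ℝ × E)

theorem isSmoothFieldOn_timeField :
    IsSmoothFieldOn (timeField (M := M) I) univ := by
  have h1 : IsManifold I 1 M := IsManifold.of_le (n := ∞) (by norm_cast)
  have h2 : ContMDiff (𝓘(ℝ, ℝ).prod I) 𝓘(ℝ, ℝ).tangent ∞
      (fun p : ℝ × M => (TotalSpace.mk' ℝ p.1 (1 : ℝ) : TangentBundle 𝓘(ℝ, ℝ) ℝ)) := fun p =>
    (contMDiffAt_constSection (1 : ℝ) p.1).comp p contMDiffAt_fst
  have h3 : ContMDiff (𝓘(ℝ, ℝ).prod I) I.tangent ∞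
      (fun p : ℝ × M => (TotalSpace.mk' E p.2 (0 : E) : TangentBundle I M)) :=
    (Bundle.contMDiff_zeroSection ℝ (TangentSpace I : M → Type _)).comp contMDiff_snd
  exact ((contMDiff_equivTangentBundleProd_symm (n := ∞)).comp (h2.prodMk h3)).contMDiffOn

theorem prodMetric_timeField (p : ℝ × M) :
    (prodMetric g).inner p (timeField I p) (timeField I p) = 1 := by
  change (1 : ℝ) * 1 + g.inner p.2 (0 : E) (0 : E) = 1
  have h : g.inner p.2 (0 : E) (0 : E) = 0 := (g.inner p.2 (0 : E)).map_zero
  rw [h, mul_one, add_zero]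

variable {g}

theorem exists_adaptedFrame {n : ℕ} (hn : Module.finrank ℝ E = n) (p : ℝ × M) :
    ∃ e ∈ adaptedFrames (n := n) g, p ∈ e.domain := by
  have hfr : Module.finrank ℝ (ℝ × E) = n + 1 := by
    rw [Module.finrank_prod, Module.finrank_self, hn, add_comm]
  obtain ⟨s, U, hU, hp, hs, h0⟩ := exists_isOrthonormalOn (g := prodMetric g)
    isSmoothFieldOn_timeField (prodMetric_timeField g) p n hfr.ge
  refine ⟨⟨U, hU, s, ⟨fun {x} hx => linearIndependent_of_inner_eq (hs.inner_eq x hx),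
    fun {x} hx => span_eq_top_of_inner_eq (hs.inner_eq x hx) hfr.symm, hs.smooth⟩⟩,
    fun q hq => ⟨?_, hs.inner_eq q hq⟩, hp⟩
  exact congrFun h0 q

theorem isOrthonormalBasisAt_of_mem_adaptedFrames {n : ℕ}
    {e : TangentFrame (𝓘(ℝ, ℝ).prod I) (ℝ × M) (n + 1)} (he : e ∈ adaptedFrames g) {p : ℝ × M}
    (hp : p ∈ e.domain) : IsOrthonormalBasisAt (prodMetric g) p fun i => e.vec i p :=
  ⟨(he p hp).2, e.isFrame.generating hp⟩

theorem eq_oneBlock {n : ℕ} {h : Matrix (Fin (n + 1)) (Fin (n + 1)) ℝ}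
    (hr : ∀ j, h 0 j = if j = 0 then 1 else 0) (hc : ∀ i, h i 0 = if i = 0 then 1 else 0) :
    h = oneBlock (Matrix.of fun i j => h i.succ j.succ) := by
  ext i j
  refine Fin.cases ?_ (fun i => ?_) i <;> refine Fin.cases ?_ (fun j => ?_) j <;>
    simp [oneBlock, hr, hc]

theorem oneBlock_injective {n : ℕ} : Function.Injective (oneBlock (n := n)) := by
  intro h k hk
  ext i j
  exact congrFun (congrFun hk i.succ) j.succ

/-- Two adapted frames differ by an element of `O_n`. -/
theorem exists_adaptedFrames_transition {n : ℕ}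
    {e e' : TangentFrame (𝓘(ℝ, ℝ).prod I) (ℝ × M) (n + 1)} (he : e ∈ adaptedFrames g)
    (he' : e' ∈ adaptedFrames g) {p : ℝ × M} (hp : p ∈ e.domain) (hp' : p ∈ e'.domain) :
    ∃ h ∈ orthogonalBlock n, ∀ i,
      e'.vec i p = ∑ j, (h : Matrix (Fin (n + 1)) (Fin (n + 1)) ℝ) i j • e.vec j p := by
  have hb := isOrthonormalBasisAt_of_mem_adaptedFrames he hp
  have hb' := isOrthonormalBasisAt_of_mem_adaptedFrames he' hp'
  let h : Matrix (Fin (n + 1)) (Fin (n + 1)) ℝ :=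
    Matrix.of fun i j => (prodMetric g).inner p (e'.vec i p) (e.vec j p)
  have h0 : e'.vec 0 p = e.vec 0 p := (he' p hp').1.trans (he p hp).1.symm
  have hblock : h = oneBlock (Matrix.of fun i j => h i.succ j.succ) := by
    refine eq_oneBlock (fun j => ?_) fun i => ?_
    · simp only [h, Matrix.of_apply]
      rw [h0, hb.inner_eq]
      simp only [eq_comm]
    · simp only [h, Matrix.of_apply]
      rw [← h0, hb'.inner_eq]
  have hsum : ∀ i, e'.vec i p = ∑ j, h i j • e.vec j p := fun i => hb.eq_sum (e'.vec i p)
  have horth : h * h.transpose = 1 := by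
    ext i j
    rw [Matrix.mul_apply, Matrix.one_apply, ← hb'.inner_eq i j]
    conv_rhs => rw [hsum i]
    rw [map_sum ((prodMetric g).inner p), sum_apply]
    refine Finset.sum_congr rfl fun k _ => ?_
    rw [map_smul ((prodMetric g).inner p), smul_apply, smul_eq_mul, (prodMetric g).symm]
    rfl
  have horth' : (Matrix.of fun i j : Fin n => h i.succ j.succ) *
      (Matrix.of fun i j : Fin n => h i.succ j.succ).transpose = 1 := by
    refine oneBlock_injective ?_
    rw [oneBlock_mul, oneBlock_transpose, ← hblock, horth, oneBlock_one]
  refine ⟨oneBlockHom n ⟨_, (Matrix.mem_orthogonalGroup_iff (Fin n) ℝ).2 horth'⟩, ⟨_, rfl⟩,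
    fun i => ?_⟩
  change e'.vec i p = ∑ j, oneBlock (Matrix.of fun i j : Fin n => h i.succ j.succ) i j • e.vec j p
  rw [← hblock]
  exact hsum i

theorem isTopologicalGStructure_adaptedFrames {n : ℕ} (hn : Module.finrank ℝ E = n) :
    IsTopologicalGStructure (orthogonalBlock n) (adaptedFrames g) where
  covers := exists_adaptedFrame hn
  transition _ he _ he' _ hp := exists_adaptedFrames_transition he he' hp.1 hp.2

end AdaptedFrames

/-! ### The Riemannian subequation of a Euclidean model -/

theorem jetAct_mem_iff {m : ℕ} {F : Set (EuclJet m)} {h : Matrix.orthogonalGroup (Fin m) ℝ}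
    (hh : h ∈ invarianceGroup F) (J : EuclJet m) :
    jetAct (h : Matrix (Fin m) (Fin m) ℝ) J ∈ F ↔ J ∈ F := by
  have hF : jetAct (h : Matrix (Fin m) (Fin m) ℝ) '' F = F := hh
  have hinj : Function.Injective (jetAct (h : Matrix (Fin m) (Fin m) ℝ)) := by
    refine Function.LeftInverse.injective
      (g := jetAct ((h⁻¹ : Matrix.orthogonalGroup (Fin m) ℝ) : Matrix (Fin m) (Fin m) ℝ))
      fun J => ?_
    rw [← jetAct_mul, ← Submonoid.coe_mul, inv_mul_cancel, OneMemClass.coe_one, jetAct_one]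
  conv_lhs => rw [← hF]
  exact hinj.mem_set_image

section Model

variable {E : Type*} [NormedAddCommGroup E] [NormedSpace ℝ E] [FiniteDimensional ℝ E]
  {H : Type*} [TopologicalSpace H] {I : ModelWithCorners ℝ E H} [I.Boundaryless]
  {X : Type*} [TopologicalSpace X] [ChartedSpace H X] [IsManifold I ∞ X]
  {g : ContMDiffRiemannianMetric I ∞ E (fun x : X => TangentSpace I x)} {m : ℕ}
  {G : Subgroup (Matrix.orthogonalGroup (Fin m) ℝ)} {𝒜 : Set (TangentFrame I X m)}
  {Fm : Set (EuclJet m)}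

theorem continuous_jetFibre_inclusion (x : X) :
    Continuous fun j : JetFibre I x => (⟨x, j⟩ : JetBundle I X) :=
  continuous_induced_dom

variable (g 𝒜 Fm) in
/-- The jets whose coordinates in some frame of `𝒜` belong to the model `Fm`. -/
def modelledSet : Set (JetBundle I X) :=
  {J | ∃ ξ ∈ 𝒜, J.base ∈ ξ.domain ∧ frameJet g J.base (fun i => ξ.vec i J.base) J.jet ∈ Fm}

theorem mem_modelledSet_iff (h𝒜 : IsTopologicalGStructure G 𝒜) (hG : G ≤ invarianceGroup Fm)
    {ξ : TangentFrame I X m} (hξ : ξ ∈ 𝒜) {J : JetBundle I X} (hJ : J.base ∈ ξ.domain) :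
    J ∈ modelledSet g 𝒜 Fm ↔ frameJet g J.base (fun i => ξ.vec i J.base) J.jet ∈ Fm := by
  refine ⟨fun ⟨ξ', hξ', hJ', h⟩ => ?_, fun h => ⟨ξ, hξ, hJ, h⟩⟩
  obtain ⟨a, ha, hsum⟩ := h𝒜.transition ξ hξ ξ' hξ' J.base ⟨hJ, hJ'⟩
  rw [frameJet_change_frame g _ _ _ hsum] at h
  exact (jetAct_mem_iff (hG ha) _).1 h

/-- Every topological `G`-structure that consists of orthonormal frames carries a Riemannian
`G`-subequation for every Euclidean subequation that is invariant under `G`. -/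
theorem isRiemannianGSubequation_modelledSet (h𝒜 : IsTopologicalGStructure G 𝒜)
    (horth : ∀ ξ ∈ 𝒜, ∀ x ∈ ξ.domain, IsOrthonormalBasisAt g x fun i => ξ.vec i x)
    (hF : IsEuclSubequation Fm) (hG : G ≤ invarianceGroup Fm) :
    IsRiemannianGSubequation g G 𝒜 Fm (modelledSet g 𝒜 Fm) := by
  set F := modelledSet g 𝒜 Fm
  have hclosed : IsClosed Fm := hF.top ▸ isClosed_closure
  have hcont : ∀ ξ ∈ 𝒜, ∀ x ∈ ξ.domain, Continuous (frameJet g x fun i => ξ.vec i x) :=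
    fun ξ hξ x hx => continuous_iff_continuousAt.2 fun j =>
      (continuousAt_frameJet g ξ (horth ξ hξ) (J := ⟨x, j⟩) hx).comp
        (continuous_jetFibre_inclusion x).continuousAt
  have hslice : ∀ ξ ∈ 𝒜, ∀ x ∈ ξ.domain,
      jetSlice I F x = (frameJet g x fun i => ξ.vec i x) ⁻¹' Fm := fun ξ hξ x hx =>
    ext fun j => mem_modelledSet_iff h𝒜 hG hξ (J := ⟨x, j⟩) hx
  have hdom : ∀ ξ ∈ 𝒜, ∀ J : JetBundle I X, J.base ∈ ξ.domain →
      ∀ᶠ K : JetBundle I X in 𝓝 J, K.base ∈ ξ.domain := fun ξ _ J hJ =>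
    continuous_jetBundle_base.continuousAt.eventually (ξ.isOpen_domain.eventually_mem hJ)
  have hint : ∀ ξ ∈ 𝒜, ∀ x ∈ ξ.domain, ∀ j : JetFibre I x,
      frameJet g x (fun i => ξ.vec i x) j ∈ interior Fm → (⟨x, j⟩ : JetBundle I X) ∈ interior F := by
    intro ξ hξ x hx j hj
    rw [mem_interior_iff_mem_nhds]
    filter_upwards [hdom ξ hξ ⟨x, j⟩ hx, (continuousAt_frameJet g ξ (horth ξ hξ)
      (J := ⟨x, j⟩) hx).eventually (isOpen_interior.eventually_mem hj)] with K h1 h2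
    exact (mem_modelledSet_iff h𝒜 hG hξ h1).2 (interior_subset h2)
  have hint' : ∀ ξ ∈ 𝒜, ∀ x ∈ ξ.domain, ∀ j ∈ interior (jetSlice I F x),
      frameJet g x (fun i => ξ.vec i x) j ∈ interior Fm := by
    intro ξ hξ x hx j hj
    obtain ⟨s, hs, hφs, hsj⟩ := (horth ξ hξ x hx).exists_section j
    refine interior_maximal (fun K hK => ?_) (isOpen_interior.preimage hs)
      (show s _ ∈ interior (jetSlice I F x) by rwa [hsj])
    have h1 := interior_subset (mem_preimage.1 hK)
    rwa [hslice ξ hξ x hx, mem_preimage, hφs] at h1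
  have hfibre : ∀ x, interior (jetSlice I F x) = jetSlice I (interior F) x := by
    intro x
    obtain ⟨ξ, hξ, hx⟩ := h𝒜.covers x
    refine Subset.antisymm (fun j hj => hint ξ hξ x hx j (hint' ξ hξ x hx j hj)) ?_
    exact interior_maximal (fun j hj => interior_subset (s := F) hj)
      (isOpen_interior.preimage (continuous_jetFibre_inclusion x))
  have htop : ∀ x, jetSlice I F x = closure (interior (jetSlice I F x)) := by
    intro x
    obtain ⟨ξ, hξ, hx⟩ := h𝒜.covers x
    refine Subset.antisymm (fun j hj => ?_) ?_
    · obtain ⟨s, hs, hφs, hsj⟩ := (horth ξ hξ x hx).exists_section j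
      have h1 : frameJet g x (fun i => ξ.vec i x) j ∈ closure (interior Fm) := by
        rw [hslice ξ hξ x hx] at hj
        exact hF.top ▸ hj
      have h2 := image_closure_subset_closure_image hs ⟨_, h1, rfl⟩
      rw [hsj] at h2
      refine closure_mono ?_ h2
      rintro _ ⟨K, hK, rfl⟩
      rw [hfibre]
      exact hint ξ hξ x hx _ (by rwa [hφs])
    · refine closure_minimal interior_subset ?_
      rw [hslice ξ hξ x hx]
      exact hclosed.preimage (hcont ξ hξ x hx)
  have hFclosed : IsClosed F := by
    refine ⟨isOpen_iff_mem_nhds.2 fun J hJ => ?_⟩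
    obtain ⟨ξ, hξ, hx⟩ := h𝒜.covers J.base
    have h1 : frameJet g J.base (fun i => ξ.vec i J.base) J.jet ∈ Fmᶜ :=
      fun h => hJ ((mem_modelledSet_iff h𝒜 hG hξ hx).2 h)
    filter_upwards [hdom ξ hξ J hx, (continuousAt_frameJet g ξ (horth ξ hξ) hx).eventually
      (hclosed.isOpen_compl.eventually_mem h1)] with K h2 h3
    exact fun h => h3 ((mem_modelledSet_iff h𝒜 hG hξ h2).1 h)
  refine ⟨h𝒜, hF, hG, ⟨fun x => ?_, fun x => ?_, Subset.antisymm ?_ ?_, htop, hfibre⟩,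
    fun ξ hξ x hx j => mem_modelledSet_iff h𝒜 hG hξ (J := ⟨x, j⟩) hx⟩
  · obtain ⟨ξ, hξ, hx⟩ := h𝒜.covers x
    rw [hslice ξ hξ x hx]
    rintro _ ⟨j, hj, k, hk, rfl⟩
    rw [mem_preimage, frameJet_add]
    exact hF.pos (add_mem_add hj (frameJet_mem_euclPos g _ hk))
  · obtain ⟨ξ, hξ, hx⟩ := h𝒜.covers x
    rw [hslice ξ hξ x hx]
    rintro _ ⟨j, hj, k, hk, rfl⟩
    rw [mem_preimage, frameJet_add]
    exact hF.neg (add_mem_add hj (frameJet_mem_euclNeg g _ hk))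
  · rintro ⟨x, j⟩ hj
    have h1 : j ∈ closure (jetSlice I (interior F) x) := by
      rw [← hfibre, ← htop]
      exact hj
    exact (continuous_jetFibre_inclusion x).closure_preimage_subset _ h1
  · exact closure_minimal interior_subset hFclosed

theorem IsRiemannianGSubequation.eq {F F' : Set (JetBundle I X)}
    (h : IsRiemannianGSubequation g G 𝒜 Fm F) (h' : IsRiemannianGSubequation g G 𝒜 Fm F') :
    F = F' := by
  ext ⟨x, j⟩
  obtain ⟨ξ, hξ, hx⟩ := h.gStructure.covers x
  rw [h.mem_iff ξ hξ x hx, h'.mem_iff ξ hξ x hx]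

end Model

end

theorem proposition2p2p1 (n : ℕ) {M : Type*} [TopologicalSpace M]
    [ChartedSpace (EuclideanSpace ℝ (Fin n)) M] [IsManifold (𝓡 n) ∞ M]
    (g : Bundle.ContMDiffRiemannianMetric (𝓡 n) ∞ (EuclideanSpace ℝ (Fin n))
      (fun x : M => TangentSpace (𝓡 n) x))
    (c : ℝ) (hc : c ∈ Set.Ioo (-((n + 1 : ℝ) * Real.pi / 2)) ((n + 1 : ℝ) * Real.pi / 2)) :
    ∃! F : Set (JetBundle (𝓘(ℝ, ℝ).prod (𝓡 n)) (ℝ × M)),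
      IsRiemannianGSubequation (prodMetric g) (orthogonalBlock n) (adaptedFrames g)
        (dslJet n c) F := by
  have h := isRiemannianGSubequation_modelledSet
    (isTopologicalGStructure_adaptedFrames (g := g) finrank_euclideanSpace_fin)
    (fun _ hξ _ hx => isOrthonormalBasisAt_of_mem_adaptedFrames hξ hx)
    (isEuclSubequation_dslJet c) (orthogonalBlock_le_invarianceGroup c)
  exact ⟨_, h, fun _ hF => hF.eq h⟩
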